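/- **Setting.** Let $(X,d)$ be a complete separable metric space with a non-negative Borel measure $m$ that is finite on bounded sets. *Weak upper gradients.* A test plan is a Borel probability measure $\pi$ on $C([0,1];X)$, concentrated on $AC^2$ curves, with $(e_s)_\#\pi\le Cm$ for some constant $C$ and all $s\in[0,1]$ (where $e_s(\gamma)=\gamma_s$), and with $\iint_0^1|\dot\gamma_s|^2\,ds\,d\pi(\gamma)<\infty$. A Borel function $G:X\to[0,\infty]$ is a weak upper gradient of $f:X\to\mathbb R$ if for every test plan $\pi$ and $\pi$-a.e. $\gamma$ one has $|f(\gamma_1)-f(\gamma_0)|\le\int_0^1G(\gamma_s)|\dot\gamma_s|\,ds<\infty$. The minimal weak upper gradient $|Df|$ is the $m$-a.e. smallest weak upper gradient of $f$, if $f$ has one. *Heat flow.* The Cheeger energy $E:L^2(m)\to[0,\infty]$ is $E(f)=\frac12\int|Df|^2\,dm$ if $f$ has a weak upper gradient in $L^2(m)$, and $E(f)=\infty$ otherwise. For $f\in L^2(m)$, the heat flow $t\mapsto h_tf$ is the $L^2(m)$-gradient flow of $E$ from $f$, that is, the unique curve that is continuous on $[0,\infty)$, locally absolutely continuous on $(0,\infty)$,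 equal to $f$ at $t=0$, and satisfies $-\frac{d}{dt}h_tf\in\partial E(h_tf)$ for a.e. $t>0$. *Heat kernel.* Assume that there are functions $r_t[x](y)\in(0,\infty)$, for $t>0$ and $x,y\in X$, such that each $r_t[x]$ is a probability density with respect to $m$ and, for all $t>0$ and $f\in L^2(m)$, $$h_tf(x)=\int f(y)\,r_t[x](y)\,dm(y)\qquad\text{for }m\text{-a.e. }x .$$ From now on $h_tf(x)$ denotes this integral, for every $x\in X$ and also for functions $f$ outside $L^2(m)$. *Harnack inequality.* Assume finally that for some $K\in\mathbb R$, all $p\in(1,\infty)$, $t>0$, $x,y\in X$ and $f\in L^1\cap L^\infty(m)$, $$|h_tf(x)|^p\le h_t(|f|^p)(y)\,\exp\Big(\frac{p\,K\,d^2(x,y)}{2(p-1)(e^{2Kt}-1)}\Big).$$ For $K=0$ the quotient $\frac{2K}{e^{2Kt}-1}$ is read as $\frac1t$, here and below. **Proposition.** Let $t>0$. Put $0\log0=0$, and for $g:X\to\mathbb R$ let $\operatorname{lip}g(x)=\limsup_{y\to x,\,y\ne x}\frac{|g(x)-g(y)|}{d(x,y)}$, with value $0$ at isolated points. 1. For every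 $f\in L^\infty(m)$ the function $h_tf$ is Lipschitz on $X$. 2. For every $f\in L^\infty(m)$ with $f\ge0$ $m$-a.e., at every point of $X$, $$\operatorname{lip}(h_tf)^2\le\frac{2K}{e^{2Kt}-1}\,h_tf\,\big(h_t(f\log f)-h_tf\,\log h_tf\big).$$ 3. For every $p\in(1,\infty)$ and every $f\in L^p(m)$ with $f\ge0$ $m$-a.e., the integrals defining $h_tf$ and $h_t(f\log f)$ converge absolutely at $m$-a.e. point, the minimal weak upper gradient $|Dh_tf|$ exists, and $$|Dh_tf|^2\le\frac{2K}{e^{2Kt}-1}\,h_tf\,\big(h_t(f\log f)-h_tf\,\log h_tf\big)\qquad m\text{-a.e.}$$ -/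

import Mathlib

open MeasureTheory Set Filter Topology
open scoped ENNReal NNReal unitInterval

namespace HeatMMS

noncomputable section

/-! ### Local Lipschitz constant and metric speed -/

/-- The local Lipschitz constant `limsup_{y → x, y ≠ x} d(f y, f x) / d(y, x)`, with values in
`[0, ∞]`; at an isolated point the filter is trivial and the value is `0`. -/
def lip {X Y : Type*} [PseudoEMetricSpace X] [PseudoEMetricSpace Y] (f : X → Y) (x : X) : ℝ≥0∞ :=
  limsup (fun y => edist (f y) (f x) / edist y x) (𝓝[≠] x)

/-- The metric speed `|γ'_t|` of a curve `γ : [0,1] → X`. For an absolutely continuous curve the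
upper limit is a limit at almost every `t`. -/
def speed {X : Type*} [PseudoEMetricSpace X] (γ : C(I, X)) (t : I) : ℝ≥0∞ :=
  lip (fun s => γ s) t

/-- `γ` belongs to `AC²([0,1]; X)`: there is `g ∈ L²(0,1)` with
`d(γ_s, γ_t) ≤ ∫_s^t g` for all `s ≤ t`. -/
def IsACCurve {X : Type*} [PseudoEMetricSpace X] (γ : C(I, X)) : Prop :=
  ∃ g : I → ℝ≥0∞, Measurable g ∧ ∫⁻ t, g t ^ 2 < ∞ ∧
    ∀ s t : I, s ≤ t → edist (γ s) (γ t) ≤ ∫⁻ τ in Icc s t, g τ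

/-! ### Weak upper gradients -/

/-- Borel σ-algebra on the space of curves (with the topology of uniform convergence). -/
instance curveMeasurableSpace {X : Type*} [TopologicalSpace X] : MeasurableSpace C(I, X) :=
  borel _

/-- The line integral `∫_γ G = ∫_0^1 G(γ_t) |γ'_t| dt`. -/
def lineIntegral {X : Type*} [PseudoEMetricSpace X] (G : X → ℝ≥0∞) (γ : C(I, X)) : ℝ≥0∞ :=
  ∫⁻ t : I, G (γ t) * speed γ t

/-- Test plans: Borel probability measures `π` on `C([0,1]; X)`, concentrated on `AC²` curves, with
`(e_t)_# π ≤ C m` for all `t` and with finite kinetic energy `∫∫ |γ'_t|² dt dπ(γ) < ∞`. -/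
structure IsTestPlan {X : Type*} [PseudoEMetricSpace X] [MeasurableSpace X] (m : Measure X)
    (π : Measure C(I, X)) : Prop where
  prob : IsProbabilityMeasure π
  ac : ∀ᵐ γ ∂π, IsACCurve γ
  compression : ∃ C : ℝ≥0, ∀ t : I, π.map (fun γ => γ t) ≤ C • m
  energy : ∫⁻ γ, (∫⁻ t : I, speed γ t ^ 2) ∂π < ∞

/-- `G : X → [0, ∞]` is a weak upper gradient of `f`: for every test plan and almost every curve,
`|f(γ_1) - f(γ_0)| ≤ ∫_γ G < ∞`. -/
def IsWeakUpperGradient {X : Type*} [PseudoEMetricSpace X] [MeasurableSpace X] (m : Measure X)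
    (f : X → ℝ) (G : X → ℝ≥0∞) : Prop :=
  Measurable G ∧ ∀ π : Measure C(I, X), IsTestPlan m π →
    ∀ᵐ γ ∂π, edist (f (γ 1)) (f (γ 0)) ≤ lineIntegral G γ ∧ lineIntegral G γ < ∞

/-- `G` is the `m`-a.e. smallest weak upper gradient of `f`. -/
def IsMinimalWeakUpperGradient {X : Type*} [PseudoEMetricSpace X] [MeasurableSpace X]
    (m : Measure X) (f : X → ℝ) (G : X → ℝ≥0∞) : Prop :=
  IsWeakUpperGradient m f G ∧ ∀ G' : X → ℝ≥0∞, IsWeakUpperGradient m f G' → G ≤ᵐ[m] G'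

open Classical in
/-- The minimal weak upper gradient `|D f|` (unique up to `m`-null sets); by convention it is `∞`
if `f` has no weak upper gradient. -/
def minWeakUpperGradient {X : Type*} [PseudoEMetricSpace X] [MeasurableSpace X]
    (m : Measure X) (f : X → ℝ) : X → ℝ≥0∞ :=
  if h : ∃ G, IsMinimalWeakUpperGradient m f G then h.choose else fun _ => ∞

/-- The Cheeger energy on `L²(m)`: it is `½ ∫ |D f|² dm` if `|D f|` exists and lies in `L²(m)`,
that is for `f ∈ W^{1,2}`, and `∞` otherwise. -/
def cheegerEnergy {X : Type*} [PseudoEMetricSpace X] [MeasurableSpace X] (m : Measure X)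
    (f : Lp ℝ 2 m) : ℝ≥0∞ :=
  2⁻¹ * ∫⁻ x, minWeakUpperGradient m f x ^ 2 ∂m

/-! ### Gradient flows and the heat flow -/

/-- The subdifferential of a functional `E : H → [0, ∞]` at `u`; it is empty where `E u = ∞`. -/
def subdifferential {H : Type*} [NormedAddCommGroup H] [InnerProductSpace ℝ H] (E : H → ℝ≥0∞)
    (u : H) : Set H :=
  {ξ | E u ≠ ∞ ∧ ∀ v, E v ≠ ∞ → (E u).toReal + inner ℝ ξ (v - u) ≤ (E v).toReal}

/-- `u : [0, ∞) → H` is the gradient flow of `E` from `f`: it is continuous on `[0, ∞)` with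
`u 0 = f`, locally absolutely continuous on `(0, ∞)`, and `-u'(t) ∈ ∂E(u(t))` for a.e. `t > 0`.
(The values of `u` at negative times play no role.) -/
structure IsGradientFlow {H : Type*} [NormedAddCommGroup H] [InnerProductSpace ℝ H]
    (E : H → ℝ≥0∞) (f : H) (u : ℝ → H) : Prop where
  init : u 0 = f
  cont : ContinuousOn u (Ici 0)
  ac : ∀ a b : ℝ, 0 < a → a ≤ b → AbsolutelyContinuousOnInterval u a b
  sol : ∀ᵐ t : ℝ, 0 < t → ∃ ξ ∈ subdifferential E (u t), HasDerivAt u (-ξ) t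

open Classical in
/-- The heat flow `t ↦ h_t f` on `L²(m)`: the gradient flow of the Cheeger energy from `f`.
It exists and is unique for every `f`, because the energy is convex and lower semicontinuous with
dense domain; the value `0` in the other case is a mere convention. -/
def heatFlow {X : Type*} [PseudoEMetricSpace X] [MeasurableSpace X] (m : Measure X) (t : ℝ)
    (f : Lp ℝ 2 m) : Lp ℝ 2 m :=
  if h : ∃ u, IsGradientFlow (cheegerEnergy m) f u then h.choose t else 0

/-! ### Heat kernel and dimension-free Harnack inequality -/

/-- The integral operator `f ↦ ∫ f(y) r_t[x](y) dm(y)` of a kernel `r`, where `r t x y` stands for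
`r_t[x](y)`. For the heat kernel this is the everywhere defined version of `h_t f`, and the
extension of `h_t` beyond `L²`. -/
def kernelFlow {X : Type*} [MeasurableSpace X] (m : Measure X) (r : ℝ → X → X → ℝ) (t : ℝ)
    (f : X → ℝ) (x : X) : ℝ :=
  ∫ y, f y * r t x y ∂m

/-- `r` is a heat kernel: for `t > 0`, `r_t[x]` is a positive probability density for every `x`,
and it represents the heat flow on `L²(m)`. -/
structure IsHeatKernel {X : Type*} [PseudoEMetricSpace X] [MeasurableSpace X] (m : Measure X)
    (r : ℝ → X → X → ℝ) : Prop where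
  pos : ∀ t, 0 < t → ∀ x y, 0 < r t x y
  integrable : ∀ t, 0 < t → ∀ x, Integrable (r t x) m
  integral_eq_one : ∀ t, 0 < t → ∀ x, ∫ y, r t x y ∂m = 1
  represents : ∀ t, 0 < t → ∀ f : Lp ℝ 2 m, heatFlow m t f =ᵐ[m] kernelFlow m r t f

/-- The factor `2K / (e^{2Kt} - 1)`, read as its limit `1 / t` for `K = 0`. -/
def rate (K t : ℝ) : ℝ :=
  if K = 0 then 1 / t else 2 * K / (Real.exp (2 * K * t) - 1)

/-- The dimension-free Harnack inequality
`|h_t f(x)|^p ≤ h_t(|f|^p)(y) exp(p K d²(x,y) / (2 (p-1) (e^{2Kt} - 1)))`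
for `p ∈ (1, ∞)`, `t > 0`, `x, y ∈ X` and `f ∈ L¹ ∩ L^∞`. -/
def DimFreeHarnack {X : Type*} [PseudoMetricSpace X] [MeasurableSpace X] (m : Measure X)
    (r : ℝ → X → X → ℝ) (K : ℝ) : Prop :=
  ∀ p : ℝ, 1 < p → ∀ t : ℝ, 0 < t → ∀ f : X → ℝ, MemLp f 1 m → MemLp f ∞ m → ∀ x y : X,
    |kernelFlow m r t f x| ^ p ≤
      kernelFlow m r t (fun z => |f z| ^ p) y *
        Real.exp (p * rate K t * dist x y ^ 2 / (4 * (p - 1)))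

/-- The right-hand side of the local logarithmic Sobolev inequality,
`2K / (e^{2Kt} - 1) · h_t f · (h_t(f log f) - h_t f log h_t f)`, with `0 log 0 = 0`. -/
def logSobolevBound {X : Type*} [MeasurableSpace X] (m : Measure X) (r : ℝ → X → X → ℝ)
    (K t : ℝ) (f : X → ℝ) (x : X) : ℝ :=
  rate K t * kernelFlow m r t f x *
    (kernelFlow m r t (fun y => f y * Real.log (f y)) x -
      kernelFlow m r t f x * Real.log (kernelFlow m r t f x))

end

end HeatMMS

open HeatMMS

set_option linter.unusedSectionVars false

/-! Write `μ_x` for the probability measure `r_t[x] m`, `κ` for the rate and `L(q, x) = log ∫ F^q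
dμ_x` for a nonnegative `F`. The logarithm of the Harnack inequality with exponent `s` bounds `s
L(1, x)` by `L(s, y) + s κ d² / (4 (s - 1))`, where `d = d(x, y)`. With `s = 1 + α d` the last term
is of first order in `d`. Convexity of `L` in `q` (Hölder) bounds `L(1 + α d, y) - L(1, y)` by `α d`
times a difference quotient of `L(·, y)` at `1`. Dividing by `d` and letting `y → x`, the local
Lipschitz constant of `L(1, ·)` at `x` is at most `α A + κ / (4 α)`, where `A = ∂_q L(1, x) - L(1,
x)` is the entropy of `F` under `μ_x` divided by `∫ F dμ_x`. The best `α` gives `√(κ A)`, and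
multiplication by `∫ F dμ_x` turns this into the logarithmic Sobolev bound
(`HarnackFamily.lip_sq_le`). The continuity used in the limit also comes from Harnack: log-moments
are bounded on bounded sets, and the increment estimate then makes the moments Lipschitz there. For
bounded `f`, adding a constant makes these bounds uniform on `X`, whence part 1.

All this needs a single moment of order `p > 1` that is finite at a single point, because Harnack
carries lower moments to every other point. For `f ∈ L^p` such a point exists since the heat flow
cannot blow up the `L¹` norm of `f^p`. The kernel is tied to the flow only on `L²`, so this is
proved on the gradient flow itself: the integral of the Huber function decreases along it, because
the derivative of that function is the truncation `T` to `[-1, 1]` and `u ↦ u - T u` does not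
increase the Cheeger energy (`IsGradientFlow.envelope_le`, `setLIntegral_heatFlow_le`).

In part 3, `lip` of a function that is Lipschitz on bounded sets is a weak upper gradient, by the
chain rule along absolutely continuous curves. A minimal weak upper gradient exists because weak
upper gradients are stable under minima and decreasing limits, and it lies below `lip` almost
everywhere. -/

namespace HeatMMS

/-! ### Lyapunov functionals of a gradient flow from convex projections -/

section GradientFlow

variable {H : Type*} [NormedAddCommGroup H] [InnerProductSpace ℝ H]

/-- The Moreau envelope `½‖u‖² - ½‖u - T u‖²` attached to a projection `T`. -/
noncomputable def envelope (T : H → H) (u : H) : ℝ :=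
  2⁻¹ * ‖u‖ ^ 2 - 2⁻¹ * ‖u - T u‖ ^ 2

/-- The hypothesis on `T` is the variational inequality of a projection onto a convex set. The
remainder equals `½‖b - a‖² + ⟨q, b - a⟩`. It is nonnegative by the inequality at `v`, and expanding
`‖v - u‖²` with both inequalities shows that it is at most `‖v - u‖²`. A quadratic remainder means
that the envelope has gradient `T`. -/
theorem envelope_sub_sub_le {T : H → H} (hT : ∀ u v, inner ℝ (u - T u) (T v - T u) ≤ 0) (u v : H) :
    |envelope T v - envelope T u - inner ℝ (T u) (v - u)| ≤ ‖v - u‖ ^ 2 := by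
  set a := T u with ha
  set b := T v with hb
  set p := u - a with hp
  set q := v - b with hq
  have h1 : inner ℝ p (b - a) ≤ 0 := hT u v
  have h2 : inner ℝ q (a - b) ≤ 0 := hT v u
  have hu : u = p + a := by simp [hp]
  have hv : v = q + b := by simp [hq]
  have hid : envelope T v - envelope T u - inner ℝ a (v - u)
      = 2⁻¹ * ‖b - a‖ ^ 2 + inner ℝ q (b - a) := by
    have e1 : envelope T v = 2⁻¹ * ‖v‖ ^ 2 - 2⁻¹ * ‖q‖ ^ 2 := rfl
    have e2 : envelope T u = 2⁻¹ * ‖u‖ ^ 2 - 2⁻¹ * ‖p‖ ^ 2 := rfl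
    rw [e1, e2, hu, hv]
    simp only [← real_inner_self_eq_norm_sq, inner_sub_left, inner_sub_right, inner_add_left,
      inner_add_right, real_inner_comm]
    ring
  have h2' : 0 ≤ inner ℝ q (b - a) := by
    rw [← neg_sub b a, inner_neg_right] at h2; linarith
  have hvu : ‖v - u‖ ^ 2 = ‖q - p‖ ^ 2 + 2 * inner ℝ (q - p) (b - a) + ‖b - a‖ ^ 2 := by
    rw [← norm_add_sq_real]; congr 2; rw [hu, hv]; abel
  have h3 : inner ℝ (q - p) (b - a) = inner ℝ q (b - a) - inner ℝ p (b - a) := inner_sub_left ..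
  rw [hid, abs_of_nonneg (by positivity), hvu, h3]
  nlinarith [sq_nonneg ‖q - p‖, sq_nonneg ‖b - a‖]

theorem hasFDerivAt_envelope {T : H → H} (hT : ∀ u v, inner ℝ (u - T u) (T v - T u) ≤ 0) (w : H) :
    HasFDerivAt (envelope T) (innerSL ℝ (T w)) w := by
  have h0 : HasFDerivAt
      (fun v => envelope T v - envelope T w - inner ℝ (T w) (v - w))
      (0 : H →L[ℝ] ℝ) w := by
    refine Asymptotics.IsBigO.hasFDerivAt (n := 2) ?_ (by norm_num)
    refine Asymptotics.IsBigO.of_bound 1 (Eventually.of_forall fun v => ?_)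
    have := envelope_sub_sub_le hT w v
    simpa using this
  have h1 : HasFDerivAt (fun v => inner ℝ (T w) (v - w)) (innerSL ℝ (T w)) w := by
    refine (((innerSL ℝ (T w)).hasFDerivAt (x := w)).sub_const
      (inner ℝ (T w) w)).congr_of_eventuallyEq (Eventually.of_forall fun v => ?_)
    simp [inner_sub_right]
  have h2 := (h0.add h1).add_const (envelope T w)
  rw [zero_add] at h2
  refine h2.congr_of_eventuallyEq (Eventually.of_forall fun v => ?_)
  simp

theorem hasDerivAt_envelope_comp {T : H → H} (hT : ∀ u v, inner ℝ (u - T u) (T v - T u) ≤ 0)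
    {u : ℝ → H} {w : H} {t : ℝ} (hu : HasDerivAt u w t) :
    HasDerivAt (fun s => envelope T (u s)) (inner ℝ (T (u t)) w) t :=
  (hasFDerivAt_envelope hT (u t)).comp_hasDerivAt t hu

theorem _root_.AbsolutelyContinuousOnInterval.of_dist_le {Y Z : Type*} [PseudoMetricSpace Y]
    [PseudoMetricSpace Z] {f : ℝ → Y} {g : ℝ → Z} {a b C : ℝ}
    (hf : AbsolutelyContinuousOnInterval f a b)
    (h : ∀ s ∈ uIcc a b, ∀ t ∈ uIcc a b, dist (g s) (g t) ≤ C * dist (f s) (f t)) :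
    AbsolutelyContinuousOnInterval g a b := by
  have h0 : Tendsto (fun E : ℕ × (ℕ → ℝ × ℝ) =>
      C * ∑ i ∈ Finset.range E.1, dist (f (E.2 i).1) (f (E.2 i).2))
      (AbsolutelyContinuousOnInterval.totalLengthFilter ⊓
        𝓟 (AbsolutelyContinuousOnInterval.disjWithin a b)) (𝓝 0) := by
    simpa using Tendsto.const_mul C hf
  refine squeeze_zero' (Eventually.of_forall fun E => Finset.sum_nonneg fun i _ => dist_nonneg)
    ?_ h0
  filter_upwards [mem_inf_of_right (mem_principal_self _)] with E hE
  rw [Finset.mul_sum]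
  exact Finset.sum_le_sum fun i hi => h _ (hE.1 i hi).1 _ (hE.1 i hi).2

theorem envelope_comp_absolutelyContinuous {T : H → H}
    (hT : ∀ u v, inner ℝ (u - T u) (T v - T u) ≤ 0) (hT0 : ∀ u, ‖T u‖ ≤ ‖u‖)
    {u : ℝ → H} {a b : ℝ} (hu : AbsolutelyContinuousOnInterval u a b) :
    AbsolutelyContinuousOnInterval (fun s => envelope T (u s)) a b := by
  obtain ⟨R, hR⟩ := hu.exists_bound
  -- The linear term contributes `‖T u‖ ≤ R`, and the quadratic remainder contributes `‖u s - u t‖ ≤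
  -- 2R`.
  refine hu.of_dist_le (C := 3 * R) fun s hs t ht => ?_
  have h1 := abs_le.1 (envelope_sub_sub_le hT (u t) (u s))
  have h2 := abs_le.1 (abs_real_inner_le_norm (T (u t)) (u s - u t))
  have h3 := hR s hs
  have h4 := hR t ht
  have h5 := norm_sub_le (u s) (u t)
  have h6 := norm_nonneg (u s - u t)
  have h7 := hT0 (u t)
  rw [Real.dist_eq, dist_eq_norm, abs_le]
  constructor <;> nlinarith

/-- Along the flow the envelope has derivative `-⟨ξ, T u⟩` with `ξ ∈ ∂E(u)`. Testing the subgradient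
inequality at `u - T u` gives `⟨ξ, T u⟩ ≥ E(u) - E(u - T u) ≥ 0`. -/
theorem IsGradientFlow.envelope_le {E : H → ℝ≥0∞} {f : H} {u : ℝ → H} (hu : IsGradientFlow E f u)
    {T : H → H} (hT : ∀ u v, inner ℝ (u - T u) (T v - T u) ≤ 0) (hT0 : ∀ u, ‖T u‖ ≤ ‖u‖)
    (hE : ∀ v, E (v - T v) ≤ E v) {t : ℝ} (ht : 0 < t) :
    envelope T (u t) ≤ envelope T f := by
  have hmono : ∀ s, 0 < s → s ≤ t → envelope T (u t) ≤ envelope T (u s) := by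
    intro s hs hst
    have hac := envelope_comp_absolutelyContinuous hT hT0 (hu.ac s t hs hst)
    have hftc := hac.integral_deriv_eq_sub
    have : ∫ x in s..t, deriv (fun r => envelope T (u r)) x ≤ 0 := by
      rw [intervalIntegral.integral_of_le hst]
      refine integral_nonpos_of_ae ?_
      have hsol : ∀ᵐ x : ℝ, x ∈ Ioc s t → deriv (fun r => envelope T (u r)) x ≤ 0 := by
        filter_upwards [hu.sol] with x hx hxs
        obtain ⟨ξ, ⟨hξ, hsub⟩, hd⟩ := hx (hs.trans hxs.1)
        rw [(hasDerivAt_envelope_comp hT hd).deriv]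
        have h1 := hE (u x)
        have h2 := hsub (u x - T (u x)) (ne_top_of_le_ne_top hξ h1)
        have h3 := ENNReal.toReal_mono hξ h1
        rw [sub_sub_cancel_left, inner_neg_right] at h2
        rw [inner_neg_right, real_inner_comm]
        linarith
      exact (ae_restrict_iff' measurableSet_Ioc).2 hsol
    linarith
  have hcont : Continuous (envelope T) :=
    continuous_iff_continuousAt.2 fun v => (hasFDerivAt_envelope hT v).continuousAt
  -- Absolute continuity holds only away from time `0`; the initial time is reached by continuity.
  have hlim : Tendsto (fun s => envelope T (u s)) (𝓝[>] 0) (𝓝 (envelope T f)) := by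
    have h1 : Tendsto u (𝓝[>] 0) (𝓝 (u 0)) :=
      (hu.cont 0 self_mem_Ici).mono_left (nhdsWithin_mono _ Ioi_subset_Ici_self)
    rw [hu.init] at h1
    exact (hcont.tendsto f).comp h1
  refine ge_of_tendsto hlim ?_
  filter_upwards [Ioc_mem_nhdsGT ht] with s hs using hmono s hs.1 hs.2

end GradientFlow

/-! ### Borel measurability of the local Lipschitz constant -/

section Lip

theorem lip_eq_iInf_iSup {X Y : Type*} [MetricSpace X] [PseudoEMetricSpace Y] (f : X → Y) (x : X) :
    lip f x = ⨅ n : ℕ, ⨆ y, ⨆ (_ : edist y x < (n + 1 : ℝ≥0∞)⁻¹ ∧ y ≠ x),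
      edist (f y) (f x) / edist y x := by
  have hb : (𝓝[≠] x).HasBasis (fun _ : ℕ => True)
      (fun n => {y | edist y x < (n + 1 : ℝ≥0∞)⁻¹ ∧ y ≠ x}) := by
    refine ((Metric.nhdsWithin_basis_eball (x := x) (s := {x}ᶜ)).to_hasBasis ?_ ?_)
    · intro ε hε
      obtain ⟨n, hn⟩ := ENNReal.exists_inv_nat_lt hε.ne'
      refine ⟨n, trivial, fun y hy => ⟨?_, hy.2⟩⟩
      refine lt_of_lt_of_le hy.1 (le_trans ?_ hn.le)
      exact ENNReal.inv_le_inv.2 le_self_add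
    · intro n _
      refine ⟨(n + 1 : ℝ≥0∞)⁻¹, by simp, fun y hy => ⟨hy.1, hy.2⟩⟩
  simp only [lip, hb.limsup_eq_iInf_iSup, iInf_true]
  rfl

/-- The local Lipschitz constant of a jointly continuous family is jointly Borel. -/
theorem measurable_lip_uncurry {Z X Y : Type*} [TopologicalSpace Z] [MeasurableSpace Z]
    [MetricSpace X] [MeasurableSpace X] [OpensMeasurableSpace (Z × X)]
    [PseudoEMetricSpace Y] {f : Z → X → Y} (hf : Continuous (fun p : Z × X => f p.1 p.2)) :
    Measurable (fun p : Z × X => lip (f p.1) p.2) := by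
  simp only [lip_eq_iInf_iSup]
  -- At a fixed scale the supremum is lower semicontinuous in both variables: a point `y` whose
  -- quotient exceeds `a` remains admissible, with quotient above `a`, after a small perturbation.
  -- No countable dense set of `y` is needed.
  refine Measurable.iInf fun n => LowerSemicontinuous.measurable ?_
  intro p a ha
  simp only [lt_iSup_iff] at ha
  obtain ⟨y, ⟨hy, hne⟩, hlt⟩ := ha
  have c1 : ContinuousAt (fun q : Z × X => edist y q.2) p := by fun_prop
  have c2 : ContinuousAt (fun q : Z × X => edist (f q.1 y) (f q.1 q.2) / edist y q.2) p := by
    have c0 : ContinuousAt (fun q : Z × X => edist (f q.1 y) (f q.1 q.2)) p :=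
      (Continuous.edist (hf.comp (by fun_prop : Continuous fun q : Z × X => (q.1, y)))
        hf).continuousAt
    exact ENNReal.Tendsto.div c0 (Or.inr (by rwa [Ne, edist_eq_zero])) c1
      (Or.inl (edist_ne_top _ _))
  have c3 : ∀ᶠ q : Z × X in 𝓝 p, y ≠ q.2 := by
    have : IsOpen {q : Z × X | y ≠ q.2} := isOpen_ne_fun continuous_const continuous_snd
    exact this.mem_nhds hne
  filter_upwards [c1.eventually_lt_const hy, c3, c2.eventually_const_lt hlt] with q h1 h2 h3
  simp only [lt_iSup_iff]
  exact ⟨y, ⟨h1, h2⟩, h3⟩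

theorem measurable_lip {X Y : Type*} [MetricSpace X] [MeasurableSpace X] [BorelSpace X]
    [PseudoEMetricSpace Y] {f : X → Y} (hf : Continuous f) : Measurable (lip f) := by
  have hc : Continuous (fun p : Unit × X => f p.2) := hf.comp continuous_snd
  have h : Measurable (fun p : Unit × X => lip f p.2) :=
    measurable_lip_uncurry (f := fun _ : Unit => f) hc
  have h' : Measurable (fun x : X => ((), x)) := measurable_prodMk_left
  have h2 := Measurable.comp (g := fun p : Unit × X => lip f p.2) h h'
  simpa only [Function.comp_def] using h2

end Lip

/-! ### Speed of curves and affine reparametrization -/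

section Curves

variable {X : Type*} [MetricSpace X]

instance : BorelSpace C(I, X) := ⟨rfl⟩

theorem measurable_speed (γ : C(I, X)) : Measurable (speed γ) := measurable_lip γ.continuous

theorem measurable_speed_uncurry [SecondCountableTopology X] :
    Measurable (fun p : C(I, X) × I => speed p.1 p.2) :=
  measurable_lip_uncurry (f := fun (γ : C(I, X)) s => γ s) (by fun_prop)

/-- The affine map `τ ↦ (1 - τ) s + τ t` of the unit interval onto `[s, t]`. -/
def affineMap (s t : I) : C(I, I) where
  toFun τ := ⟨(1 - τ) * s + τ * t, by
    have := τ.2; have := s.2; have := t.2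
    simp only [mem_Icc] at *
    constructor <;> nlinarith⟩
  continuous_toFun := by fun_prop

theorem affineMap_zero (s t : I) : affineMap s t 0 = s := by
  ext; simp [affineMap]

theorem affineMap_one (s t : I) : affineMap s t 1 = t := by
  ext; simp [affineMap]

theorem edist_affineMap {s t : I} (hst : s ≤ t) (a b : I) :
    edist (affineMap s t a) (affineMap s t b) = ENNReal.ofReal (t - s) * edist a b := by
  have h : (0 : ℝ) ≤ t - s := sub_nonneg.2 hst
  rw [edist_dist, edist_dist, ← ENNReal.ofReal_mul h, Subtype.dist_eq, Subtype.dist_eq,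
    Real.dist_eq, Real.dist_eq]
  conv_rhs => rw [← abs_of_nonneg h, ← abs_mul]
  congr 2
  simp [affineMap]
  ring

theorem affineMap_injective {s t : I} (hst : s < t) : Function.Injective (affineMap s t) := by
  intro a b hab
  have h := congrArg Subtype.val hab
  have h' : (s : ℝ) < t := hst
  simp only [affineMap, ContinuousMap.coe_mk] at h
  ext
  have : ((a : ℝ) - b) * (t - s) = 0 := by linarith
  rcases mul_eq_zero.1 this with h | h <;> linarith

theorem affineMap_mono {s t : I} (hst : s ≤ t) : Monotone (affineMap s t) := by
  intro a b hab
  have h1 : (a : ℝ) ≤ b := hab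
  have h2 : (s : ℝ) ≤ t := hst
  change (1 - a : ℝ) * s + a * t ≤ (1 - b : ℝ) * s + b * t
  nlinarith

theorem lintegral_unitInterval (h : I → ℝ≥0∞) :
    ∫⁻ τ, h τ = ∫⁻ x in Icc (0 : ℝ) 1, h (projIcc 0 1 zero_le_one x) := by
  rw [← lintegral_subtype_comap measurableSet_Icc]
  simp only [projIcc_val]
  rfl

theorem setLIntegral_unitInterval (h : I → ℝ≥0∞) (s t : I) :
    ∫⁻ τ in Icc s t, h τ = ∫⁻ x in Icc (s : ℝ) t, h (projIcc 0 1 zero_le_one x) := by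
  rw [← lintegral_indicator measurableSet_Icc, lintegral_unitInterval]
  have h1 : Icc (s : ℝ) t = Icc (s : ℝ) t ∩ Icc 0 1 :=
    (inter_eq_left.2 (Icc_subset_Icc s.2.1 t.2.2)).symm
  rw [h1, ← Measure.restrict_restrict measurableSet_Icc,
    ← lintegral_indicator (measurableSet_Icc (a := (s : ℝ)) (b := t))]
  refine setLIntegral_congr_fun measurableSet_Icc fun x hx => ?_
  have : projIcc 0 1 zero_le_one x ∈ Icc s t ↔ x ∈ Icc (s : ℝ) t := by
    rw [projIcc_of_mem _ hx]; rfl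
  by_cases hxs : x ∈ Icc (s : ℝ) t
  · simp [indicator_of_mem hxs, indicator_of_mem (this.2 hxs)]
  · simp [indicator_of_notMem hxs, indicator_of_notMem (mt this.1 hxs)]

theorem lintegral_affineMap {s t : I} (hst : s < t) (h : I → ℝ≥0∞) :
    ∫⁻ τ, ENNReal.ofReal (t - s) * h (affineMap s t τ) = ∫⁻ τ in Icc s t, h τ := by
  have hst' : (s : ℝ) < t := hst
  rw [setLIntegral_unitInterval, lintegral_unitInterval]
  have himg : (fun x : ℝ => (1 - x) * s + x * t) '' Icc 0 1 = Icc (s : ℝ) t := by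
    ext x
    constructor
    · rintro ⟨a, ha, rfl⟩
      simp only [mem_Icc] at ha ⊢
      constructor <;> nlinarith
    · rintro ⟨h1, h2⟩
      have h' : (0 : ℝ) < t - s := sub_pos.2 hst
      refine ⟨(x - s) / (t - s), ?_, ?_⟩
      · rw [mem_Icc, le_div_iff₀ h', div_le_iff₀ h']; constructor <;> linarith
      · field_simp
        ring
  rw [← himg, lintegral_image_eq_lintegral_abs_deriv_mul (f' := fun _ => (t : ℝ) - s)
    measurableSet_Icc]
  · refine setLIntegral_congr_fun measurableSet_Icc fun x hx => ?_
    rw [abs_of_pos (sub_pos.2 hst')]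
    congr 2
    rw [projIcc_of_mem _ hx]
    exact (projIcc_of_mem _ (affineMap s t ⟨x, hx⟩).2).symm
  · intro x _
    have : HasDerivAt (fun x : ℝ => (1 - x) * s + x * t) ((-1) * s + 1 * t) x :=
      (((hasDerivAt_id x).const_sub 1).mul_const _).add ((hasDerivAt_id x).mul_const _)
    convert! this.hasDerivWithinAt using 1
    ring
  · intro x _ y _ hxy
    simp only at hxy
    have : (x - y) * ((t : ℝ) - s) = 0 := by linarith
    rcases mul_eq_zero.1 this with h | h <;> linarith

theorem setLIntegral_affineMap {s t : I} (hst : s < t) (h : I → ℝ≥0∞) (a b : I) :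
    ∫⁻ τ in Icc a b, ENNReal.ofReal (t - s) * h (affineMap s t τ)
      = ∫⁻ τ in Icc (affineMap s t a) (affineMap s t b), h τ := by
  have hord : ∀ x y : I, affineMap s t x ≤ affineMap s t y ↔ x ≤ y := fun x y =>
    (((affineMap_mono hst.le).strictMono_of_injective (affineMap_injective hst))).le_iff_le
  have hsub : Icc (affineMap s t a) (affineMap s t b) ⊆ Icc s t := by
    have h0 := affineMap_mono hst.le (unitInterval.nonneg' : 0 ≤ a)
    have h1 := affineMap_mono hst.le (unitInterval.le_one' : b ≤ 1)
    rw [affineMap_zero] at h0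
    rw [affineMap_one] at h1
    exact Icc_subset_Icc h0 h1
  rw [← inter_eq_left.2 hsub, ← Measure.restrict_restrict measurableSet_Icc,
    ← lintegral_indicator measurableSet_Icc, ← lintegral_indicator measurableSet_Icc,
    ← lintegral_affineMap hst]
  refine lintegral_congr fun τ => ?_
  by_cases hτ : τ ∈ Icc a b
  · rw [indicator_of_mem hτ, indicator_of_mem (s := Icc (affineMap s t a) _)
      ⟨(hord _ _).2 hτ.1, (hord _ _).2 hτ.2⟩]
  · rw [indicator_of_notMem hτ, indicator_of_notMem, mul_zero]
    intro h'
    exact hτ ⟨(hord _ _).1 h'.1, (hord _ _).1 h'.2⟩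

/-- Only one inequality is claimed: at the endpoints the reparametrized curve sees a one-sided
neighbourhood, so its upper limit runs along a smaller filter. -/
theorem speed_comp_affineMap_le (γ : C(I, X)) {s t : I} (hst : s < t) (τ : I) :
    speed (γ.comp (affineMap s t)) τ ≤ ENNReal.ofReal (t - s) * speed γ (affineMap s t τ) := by
  have hc : ENNReal.ofReal ((t : ℝ) - s) ≠ 0 := by
    simpa using hst
  have htend : Tendsto (affineMap s t) (𝓝[≠] τ) (𝓝[≠] (affineMap s t τ)) := by
    refine tendsto_nhdsWithin_iff.2
      ⟨(affineMap s t).continuous.continuousAt.tendsto.mono_left nhdsWithin_le_nhds, ?_⟩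
    filter_upwards [self_mem_nhdsWithin] with y hy
    exact fun h => hy (affineMap_injective hst h)
  have hlim : limsup (fun y => edist (γ (affineMap s t y)) (γ (affineMap s t τ)) /
      edist (affineMap s t y) (affineMap s t τ)) (𝓝[≠] τ) ≤ speed γ (affineMap s t τ) :=
    limsup_le_limsup_of_le (u := fun z => edist (γ z) (γ (affineMap s t τ)) /
      edist z (affineMap s t τ)) htend
  refine le_trans (le_of_eq ?_) (mul_le_mul_right hlim _)
  rw [← ENNReal.limsup_const_mul_of_ne_top ENNReal.ofReal_ne_top]
  simp only [speed, lip]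
  congr 1
  ext y
  rw [edist_affineMap hst.le, ← mul_div_assoc]
  exact (ENNReal.mul_div_mul_left _ _ hc ENNReal.ofReal_ne_top).symm

end Curves

/-! ### Measurability of the set of absolutely continuous curves; restriction of test plans -/

section Curves

variable {X : Type*} [MetricSpace X]

/-- Curves whose metric speed is dominated by a function of `L²` norm at most `R`. -/
def acBall (X : Type*) [MetricSpace X] (R : ℝ) : Set C(I, X) :=
  {γ | ∃ g : Lp ℝ 2 (volume : Measure I), ‖g‖ ≤ R ∧
    ∀ s t : I, s ≤ t → dist (γ s) (γ t) ≤ ∫ τ in Icc s t, g τ}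

/-- Weak compactness of balls in `L²`: along an ultrafilter of curves the dominating functions
converge weakly, and the condition on them passes to the limit because it pairs them with indicators
of intervals. Closedness makes the set of `AC²` curves a countable union of closed sets, hence
Borel, as is needed to push "almost every curve" forward. -/
theorem isClosed_acBall (R : ℝ) : IsClosed (acBall X R) := by
  rw [isClosed_iff_ultrafilter]
  intro γ U hU hmem
  have hex : ∀ γ' : C(I, X), ∃ g : Lp ℝ 2 (volume : Measure I), γ' ∈ acBall X R → ‖g‖ ≤ R ∧
      ∀ s t : I, s ≤ t → dist (γ' s) (γ' t) ≤ ∫ τ in Icc s t, g τ := by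
    intro γ'
    by_cases h : γ' ∈ acBall X R
    · obtain ⟨g, hg⟩ := h
      exact ⟨g, fun _ => hg⟩
    · exact ⟨0, fun h' => absurd h' h⟩
  choose G hG using hex
  let Φ : C(I, X) → WeakDual ℝ (Lp ℝ 2 (volume : Measure I)) := fun γ' =>
    WeakDual.toStrongDual.symm (InnerProductSpace.toDual ℝ _ (G γ'))
  have hΦ : ∀ γ' f, Φ γ' f = inner ℝ (G γ') f := fun γ' f => rfl
  obtain ⟨ℓ, hℓ, hlim⟩ := (WeakDual.isCompact_closedBall (𝕜 := ℝ)
    (0 : StrongDual ℝ (Lp ℝ 2 (volume : Measure I))) R).ultrafilter_le_nhds (U.map Φ) (by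
      rw [le_principal_iff]
      refine Filter.mem_of_superset (x := Φ '' acBall X R)
        (Filter.image_mem_map hmem) ?_
      rintro _ ⟨γ', h, rfl⟩
      simp only [mem_preimage, Metric.mem_closedBall, dist_zero_right]
      have : ‖InnerProductSpace.toDual ℝ _ (G γ')‖ ≤ R := by
        rw [LinearIsometryEquiv.norm_map]; exact (hG γ' h).1
      exact this)
  simp only [mem_preimage, Metric.mem_closedBall, dist_zero_right] at hℓ
  let g := (InnerProductSpace.toDual ℝ (Lp ℝ 2 (volume : Measure I))).symm (WeakDual.toStrongDual ℓ)
  have hg : ∀ f, inner ℝ g f = ℓ f := fun f =>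
    InnerProductSpace.toDual_symm_apply
  refine ⟨g, ?_, fun s t hst => ?_⟩
  · rw [LinearIsometryEquiv.norm_map]; exact hℓ
  · have hμ : (volume : Measure I) (Icc s t) ≠ ∞ := measure_ne_top _ _
    have hkey : ∀ f : Lp ℝ 2 (volume : Measure I), ∫ τ in Icc s t, f τ =
        inner ℝ f (indicatorConstLp 2 measurableSet_Icc hμ (1 : ℝ)) := fun f => by
      rw [real_inner_comm, L2.inner_indicatorConstLp_one]
    rw [hkey, hg]
    have h1 : Tendsto (fun γ' => Φ γ' (indicatorConstLp 2 measurableSet_Icc hμ (1 : ℝ))) U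
        (𝓝 (ℓ (indicatorConstLp 2 measurableSet_Icc hμ (1 : ℝ)))) :=
      ((WeakDual.eval_continuous _).tendsto ℓ).comp hlim
    have h2 : Tendsto (fun γ' : C(I, X) => dist (γ' s) (γ' t)) U (𝓝 (dist (γ s) (γ t))) := by
      have : Continuous (fun γ' : C(I, X) => dist (γ' s) (γ' t)) := by fun_prop
      exact (this.tendsto γ).mono_left hU
    refine le_of_tendsto_of_tendsto h2 h1 ?_
    filter_upwards [hmem] with γ' hγ'
    rw [hΦ, ← hkey]
    exact (hG γ' hγ').2 s t hst

theorem isACCurve_iff_exists_mem_acBall (γ : C(I, X)) :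
    IsACCurve γ ↔ ∃ n : ℕ, γ ∈ acBall X n := by
  constructor
  · rintro ⟨g, hgm, hg2, hg⟩
    have hmem : MemLp (fun t => (g t).toReal) 2 (volume : Measure I) := by
      refine ⟨hgm.ennreal_toReal.aestronglyMeasurable, ?_⟩
      rw [eLpNorm_lt_top_iff_lintegral_rpow_enorm_lt_top (by norm_num) (by norm_num)]
      refine lt_of_le_of_lt (lintegral_mono fun t => ?_) hg2
      simp only [ENNReal.toReal_ofNat, ENNReal.rpow_ofNat]
      gcongr
      rw [Real.enorm_eq_ofReal ENNReal.toReal_nonneg]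
      exact ENNReal.ofReal_toReal_le
    have hfin : ∀ᵐ t : I, g t < ∞ := by
      filter_upwards [ae_lt_top (hgm.pow_const 2) hg2.ne] with t ht
      by_contra h
      rw [not_lt, top_le_iff] at h
      simp [h] at ht
    obtain ⟨n, hn⟩ := exists_nat_ge ‖hmem.toLp _‖
    refine ⟨n, hmem.toLp _, hn, fun s t hst => ?_⟩
    have hint : Integrable (fun t => (g t).toReal) (volume : Measure I) :=
      hmem.integrable (by norm_num)
    have h1 : ∫ τ in Icc s t, hmem.toLp _ τ = ∫ τ in Icc s t, (g τ).toReal :=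
      integral_congr_ae (ae_restrict_of_ae hmem.coeFn_toLp)
    have h2 := hg s t hst
    rw [h1, integral_toReal hgm.aemeasurable.restrict (ae_restrict_of_ae hfin)]
    have h3 : ∫⁻ τ in Icc s t, g τ ≠ ∞ := by
      have h4 := hint.2
      have : ∫⁻ τ, g τ ≠ ∞ := by
        rw [← lt_top_iff_ne_top]
        refine lt_of_le_of_lt (lintegral_mono_ae ?_) h4
        filter_upwards [hfin] with τ hτ
        rw [Real.enorm_eq_ofReal ENNReal.toReal_nonneg, ENNReal.ofReal_toReal hτ.ne]
      exact ne_top_of_le_ne_top this (setLIntegral_le_lintegral _ _)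
    rw [edist_dist] at h2
    exact (ENNReal.ofReal_le_iff_le_toReal h3).1 h2
  · rintro ⟨n, g, -, hg⟩
    refine ⟨fun t => ENNReal.ofReal (g t), (Lp.stronglyMeasurable g).measurable.ennreal_ofReal,
      ?_, fun s t hst => ?_⟩
    · have := (Lp.memLp g).2
      rw [eLpNorm_lt_top_iff_lintegral_rpow_enorm_lt_top (by norm_num) (by norm_num)] at this
      refine lt_of_le_of_lt (lintegral_mono fun t => ?_) this
      simp only [ENNReal.toReal_ofNat, ENNReal.rpow_ofNat]
      gcongr
      rw [← ofReal_norm]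
      exact ENNReal.ofReal_le_ofReal (Real.le_norm_self _)
    · rw [edist_dist]
      refine (ENNReal.ofReal_le_ofReal (hg s t hst)).trans ?_
      have hint : Integrable (fun t => g t) (volume : Measure I) :=
        (Lp.memLp g).integrable (by norm_num)
      refine (ENNReal.ofReal_le_ofReal (integral_mono hint.restrict hint.pos_part.restrict
        fun t => le_max_left _ 0)).trans (le_of_eq ?_)
      rw [ofReal_integral_eq_lintegral_ofReal hint.pos_part.restrict
        (Eventually.of_forall fun t => le_max_right _ _)]
      refine lintegral_congr fun t => ?_
      rw [ENNReal.ofReal_max]; simp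

theorem measurableSet_isACCurve : MeasurableSet {γ : C(I, X) | IsACCurve γ} := by
  have : {γ : C(I, X) | IsACCurve γ} = ⋃ n : ℕ, acBall X n := by
    ext γ; simp [isACCurve_iff_exists_mem_acBall]
  rw [this]
  exact MeasurableSet.iUnion fun n => (isClosed_acBall _).measurableSet

theorem IsACCurve.comp_affineMap {γ : C(I, X)} (hγ : IsACCurve γ) {s t : I} (hst : s < t) :
    IsACCurve (γ.comp (affineMap s t)) := by
  obtain ⟨g, hgm, hg2, hg⟩ := hγ
  refine ⟨fun τ => ENNReal.ofReal (t - s) * g (affineMap s t τ),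
    (hgm.comp (affineMap s t).continuous.measurable).const_mul _, ?_, fun a b hab => ?_⟩
  -- The square produces `(t - s)²`, while the change of variables absorbs one factor `t - s`; the
  -- other is at most `1`.
  · have h1 : ENNReal.ofReal ((t : ℝ) - s) ≤ 1 := by
      rw [ENNReal.ofReal_le_one]; linarith [t.2.2, s.2.1]
    calc ∫⁻ τ, (ENNReal.ofReal (t - s) * g (affineMap s t τ)) ^ 2
        ≤ ∫⁻ τ, ENNReal.ofReal (t - s) * (fun x => g x ^ 2) (affineMap s t τ) := by
          refine lintegral_mono fun τ => ?_
          rw [mul_pow]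
          refine mul_le_mul_left ?_ _
          exact pow_le_of_le_one zero_le h1 two_ne_zero
      _ = ∫⁻ τ in Icc s t, g τ ^ 2 := lintegral_affineMap hst (fun x => g x ^ 2)
      _ < ∞ := (setLIntegral_le_lintegral _ _).trans_lt hg2
  · rw [setLIntegral_affineMap hst]
    exact hg _ _ (affineMap_mono hst.le hab)

theorem lintegral_speed_sq_comp_affineMap_le (γ : C(I, X)) {s t : I} (hst : s < t) :
    ∫⁻ τ, speed (γ.comp (affineMap s t)) τ ^ 2 ≤ ∫⁻ τ, speed γ τ ^ 2 := by
  have h1 : ENNReal.ofReal ((t : ℝ) - s) ≤ 1 := by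
    rw [ENNReal.ofReal_le_one]; linarith [t.2.2, s.2.1]
  calc ∫⁻ τ, speed (γ.comp (affineMap s t)) τ ^ 2
      ≤ ∫⁻ τ, ENNReal.ofReal (t - s) * (fun x => speed γ x ^ 2) (affineMap s t τ) := by
        refine lintegral_mono fun τ => ?_
        refine (pow_le_pow_left' (speed_comp_affineMap_le γ hst τ) 2).trans ?_
        rw [mul_pow]
        refine mul_le_mul_left ?_ _
        exact pow_le_of_le_one zero_le h1 two_ne_zero
    _ = ∫⁻ τ in Icc s t, speed γ τ ^ 2 := lintegral_affineMap hst (fun x => speed γ x ^ 2)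
    _ ≤ _ := setLIntegral_le_lintegral _ _

theorem lineIntegral_comp_affineMap_le (G : X → ℝ≥0∞) (γ : C(I, X)) {s t : I} (hst : s < t) :
    lineIntegral G (γ.comp (affineMap s t)) ≤ ∫⁻ τ in Icc s t, G (γ τ) * speed γ τ := by
  rw [← lintegral_affineMap hst]
  refine lintegral_mono fun τ => ?_
  refine (mul_le_mul_right (speed_comp_affineMap_le γ hst τ) _).trans (le_of_eq ?_)
  simp only [ContinuousMap.comp_apply]
  ring

variable [MeasurableSpace X] [BorelSpace X] {m : Measure X}

theorem measurable_eval (t : I) : Measurable (fun γ : C(I, X) => γ t) :=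
  (by fun_prop : Continuous fun γ : C(I, X) => γ t).measurable

/-- This is what localizes the definition of a weak upper gradient: the inequality between the times
`0` and `1`, applied to the restricted plan, becomes the inequality between `s` and `t`. -/
theorem IsTestPlan.restrict {π : Measure C(I, X)} (hπ : IsTestPlan m π) {s t : I} (hst : s < t) :
    IsTestPlan m (π.map fun γ => γ.comp (affineMap s t)) := by
  have hm : Measurable (fun γ : C(I, X) => γ.comp (affineMap s t)) :=
    (ContinuousMap.continuous_precomp _).measurable
  refine ⟨?_, ?_, ?_, ?_⟩
  · have := hπ.prob
    exact Measure.isProbabilityMeasure_map hm.aemeasurable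
  · rw [ae_map_iff hm.aemeasurable measurableSet_isACCurve]
    filter_upwards [hπ.ac] with γ hγ using hγ.comp_affineMap hst
  · obtain ⟨C, hC⟩ := hπ.compression
    refine ⟨C, fun τ => ?_⟩
    rw [Measure.map_map (measurable_eval τ) hm]
    exact hC (affineMap s t τ)
  · refine (lintegral_map_le _ _).trans_lt (lt_of_le_of_lt (lintegral_mono fun γ => ?_) hπ.energy)
    exact lintegral_speed_sq_comp_affineMap_le γ hst

theorem IsTestPlan.ae_of_ae {π : Measure C(I, X)} (hπ : IsTestPlan m π) (t : I) {P : X → Prop}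
    (h : ∀ᵐ x ∂m, P x) : ∀ᵐ γ ∂π, P (γ t) := by
  obtain ⟨C, hC⟩ := hπ.compression
  refine ae_of_ae_map (measurable_eval t).aemeasurable ?_
  exact (Measure.absolutelyContinuous_of_le_smul (hC t)).ae_le h

theorem IsTestPlan.ae_lintegral_speed_lt_top [SecondCountableTopology X] {π : Measure C(I, X)}
    (hπ : IsTestPlan m π) : ∀ᵐ γ ∂π, ∫⁻ t, speed γ t < ∞ := by
  have hmeas : Measurable (fun γ : C(I, X) => ∫⁻ t : I, speed γ t ^ 2) :=
    (measurable_speed_uncurry.pow_const 2).lintegral_prod_right'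
  filter_upwards [ae_lt_top hmeas hπ.energy.ne] with γ hγ
  refine lt_of_le_of_lt (b := ∫⁻ t, (1 + speed γ t ^ 2)) (lintegral_mono fun t => ?_) ?_
  · rcases le_total (speed γ t) 1 with h | h
    · exact h.trans le_self_add
    · exact (le_self_pow₀ h two_ne_zero).trans le_add_self
  · rw [lintegral_add_left measurable_const]
    simpa using hγ

end Curves

/-! ### Increments bounded by two integrable functions -/

section Partition

/-- The point `min (k / N) 1` of the uniform partition of the unit interval. -/
noncomputable def gridPoint (N k : ℕ) : I := projIcc 0 1 zero_le_one ((k : ℝ) / N)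

theorem gridPoint_mono (N : ℕ) : Monotone (gridPoint N) := fun a b hab =>
  monotone_projIcc _ (by gcongr)

theorem gridPoint_zero (N : ℕ) : gridPoint N 0 = 0 := by
  simp [gridPoint]

theorem gridPoint_self {N : ℕ} (hN : N ≠ 0) : gridPoint N N = 1 := by
  have : (N : ℝ) / N = 1 := div_self (by exact_mod_cast hN)
  rw [gridPoint, this]
  exact projIcc_right (zero_le_one' ℝ)

theorem dist_gridPoint_succ_le (N k : ℕ) : dist (gridPoint N k) (gridPoint N (k + 1)) ≤ 1 / N := by
  have h : ∀ x y : ℝ, dist (projIcc (0 : ℝ) 1 zero_le_one x) (projIcc 0 1 zero_le_one y) ≤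
      dist x y := fun x y => by
    simpa using (LipschitzWith.projIcc (zero_le_one' ℝ)).dist_le_mul x y
  refine (h _ _).trans (le_of_eq ?_)
  rw [Real.dist_eq, ← sub_div]
  push_cast
  rw [abs_div, Nat.abs_cast]
  congr 1
  simp

theorem sum_measure_inter_Ioc_gridPoint_le (μ : Measure I) (A : Set I) (hA : MeasurableSet A)
    (N n : ℕ) :
    ∑ k ∈ Finset.range n, μ (Ioc (gridPoint N k) (gridPoint N (k + 1)) ∩ A) ≤ μ A := by
  have hd : Pairwise (Function.onFun Disjoint fun k =>
      Ioc (gridPoint N k) (gridPoint N (k + 1)) ∩ A) := by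
    intro a b hab
    exact ((gridPoint_mono N).pairwise_disjoint_on_Ioc_succ hab).mono inter_subset_left
      inter_subset_left
  rw [← measure_biUnion_finset (fun a _ b _ hab => hd hab)
    fun k _ => measurableSet_Ioc.inter hA]
  exact measure_mono (iUnion₂_subset fun k _ => inter_subset_right)

/-- If the increments of `v` along all uniform partitions are controlled by two integrable
functions, the total increment is controlled by their minimum. -/
theorem edist_le_lintegral_min {Y : Type*} [PseudoEMetricSpace Y] {v : I → Y} {h₁ h₂ : I → ℝ≥0∞}
    (hm₁ : Measurable h₁) (hm₂ : Measurable h₂) (hf₁ : ∫⁻ t, h₁ t ≠ ∞) (hf₂ : ∫⁻ t, h₂ t ≠ ∞)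
    (hv₁ : ∀ N k, edist (v (gridPoint N k)) (v (gridPoint N (k + 1)))
      ≤ ∫⁻ t in Icc (gridPoint N k) (gridPoint N (k + 1)), h₁ t)
    (hv₂ : ∀ N k, edist (v (gridPoint N k)) (v (gridPoint N (k + 1)))
      ≤ ∫⁻ t in Icc (gridPoint N k) (gridPoint N (k + 1)), h₂ t) :
    edist (v 0) (v 1) ≤ ∫⁻ t, min (h₁ t) (h₂ t) := by
  set μ₁ := (volume : Measure I).withDensity h₁ with hμ₁
  set μ₂ := (volume : Measure I).withDensity h₂ with hμ₂
  have : IsFiniteMeasure μ₁ := isFiniteMeasure_withDensity hf₁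
  have : IsFiniteMeasure μ₂ := isFiniteMeasure_withDensity hf₂
  set A := {t | h₁ t ≤ h₂ t} with hA
  have hAm : MeasurableSet A := measurableSet_le hm₁ hm₂
  have hmin : ∫⁻ t, min (h₁ t) (h₂ t) = μ₁ A + μ₂ Aᶜ := by
    rw [← lintegral_add_compl _ hAm, withDensity_apply _ hAm, withDensity_apply _ hAm.compl]
    congr 1
    · exact setLIntegral_congr_fun hAm fun t ht => min_eq_left ht
    · exact setLIntegral_congr_fun hAm.compl fun t ht => min_eq_right (le_of_not_ge ht)
  rw [hmin]
  refine ENNReal.le_of_forall_pos_le_add fun ε hε _ => ?_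
  have hε' : (ε / 2 : ℝ≥0∞) ≠ 0 := by simp [hε.ne']
  -- Inner regularity is used crosswise: `A \ K₁` is small for `μ₂` and `Aᶜ \ K₂` for `μ₁`, which
  -- are the masses charged when a cell uses the wrong function. Disjoint compact sets lie at
  -- positive distance, so no cell of a fine partition meets both.
  obtain ⟨K₁, hK₁A, hK₁, hK₁ε⟩ := hAm.exists_isCompact_sdiff_lt (measure_ne_top μ₂ A) hε'
  obtain ⟨K₂, hK₂A, hK₂, hK₂ε⟩ := hAm.compl.exists_isCompact_sdiff_lt (measure_ne_top μ₁ Aᶜ) hε'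
  have hdisj : Disjoint K₁ K₂ := (disjoint_compl_right (a := A)).mono hK₁A hK₂A
  obtain ⟨δ, hδ, hthick⟩ := hdisj.exists_thickenings hK₁ hK₂.isClosed
  obtain ⟨N, hN⟩ := exists_nat_one_div_lt hδ
  set p := gridPoint (N + 1) with hp
  have hIcc : ∀ (μ : Measure I) (h : I → ℝ≥0∞) (a b : I), μ = (volume : Measure I).withDensity h →
      ∫⁻ t in Icc a b, h t = μ (Ioc a b) := fun μ h a b hμ => by
    rw [hμ, withDensity_apply _ measurableSet_Ioc, restrict_Ioc_eq_restrict_Icc]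
  -- A cell that meets `K₂` uses `h₂`; it misses `K₁`, so the excess lies in `A \ K₁`. Any other
  -- cell uses `h₁`, with excess in `Aᶜ \ K₂`.
  have hstep : ∀ k, edist (v (p k)) (v (p (k + 1))) ≤
      (μ₁ (Ioc (p k) (p (k + 1)) ∩ A) + μ₂ (Ioc (p k) (p (k + 1)) ∩ Aᶜ)) +
      (μ₁ (Ioc (p k) (p (k + 1)) ∩ (Aᶜ \ K₂)) + μ₂ (Ioc (p k) (p (k + 1)) ∩ (A \ K₁))) := by
    intro k
    by_cases hmeet : (Ioc (p k) (p (k + 1)) ∩ K₂).Nonempty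
    · have hno : Ioc (p k) (p (k + 1)) ∩ A ⊆ Ioc (p k) (p (k + 1)) ∩ (A \ K₁) := by
        rintro x ⟨hx, hxA⟩
        refine ⟨hx, hxA, fun hxK => ?_⟩
        obtain ⟨y, hy, hyK⟩ := hmeet
        refine disjoint_left.1 hthick (Metric.self_subset_thickening hδ _ hxK)
          (Metric.mem_thickening_iff.2 ⟨y, hyK, ?_⟩)
        have h1 := dist_gridPoint_succ_le (N + 1) k
        have h2 : dist x y ≤ dist (p k) (p (k + 1)) := by
          have := abs_sub_le_of_le_of_le (a := (x : ℝ)) (b := y) (lb := p k) (ub := p (k + 1))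
            hx.1.le hx.2 hy.1.le hy.2
          rw [Subtype.dist_eq, Subtype.dist_eq, Real.dist_eq, Real.dist_eq,
            abs_sub_comm (p k : ℝ)]
          exact this.trans (le_abs_self _)
        push_cast at h1
        linarith
      have h := hv₂ (N + 1) k
      rw [hIcc μ₂ h₂ _ _ hμ₂, ← measure_inter_add_sdiff _ hAm] at h
      refine h.trans ?_
      rw [Set.sdiff_eq, add_comm]
      exact add_le_add le_add_self ((measure_mono hno).trans le_add_self)
    · have hno : Ioc (p k) (p (k + 1)) ∩ Aᶜ ⊆ Ioc (p k) (p (k + 1)) ∩ (Aᶜ \ K₂) := by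
        rintro x ⟨hx, hxA⟩
        exact ⟨hx, hxA, fun hxK => hmeet ⟨x, hx, hxK⟩⟩
      have h := hv₁ (N + 1) k
      rw [hIcc μ₁ h₁ _ _ hμ₁, ← measure_inter_add_sdiff _ hAm] at h
      refine h.trans ?_
      rw [Set.sdiff_eq]
      exact add_le_add le_self_add ((measure_mono hno).trans le_self_add)
  have h0 : p 0 = 0 := gridPoint_zero _
  have h1 : p (N + 1) = 1 := gridPoint_self N.succ_ne_zero
  have hsum := edist_le_range_sum_edist (fun k => v (p k)) (N + 1)
  simp only [h0, h1] at hsum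
  refine hsum.trans ((Finset.sum_le_sum fun k _ => hstep k).trans ?_)
  simp only [Finset.sum_add_distrib]
  have hS := fun (μ : Measure I) (B : Set I) (hB : MeasurableSet B) =>
    sum_measure_inter_Ioc_gridPoint_le μ B hB (N + 1) (N + 1)
  refine add_le_add (add_le_add (hS _ _ hAm) (hS _ _ hAm.compl)) ?_
  calc _ ≤ (ε / 2 : ℝ≥0∞) + ε / 2 := add_le_add
        ((hS _ _ (hAm.compl.diff hK₂.measurableSet)).trans hK₂ε.le)
        ((hS _ _ (hAm.diff hK₁.measurableSet)).trans hK₁ε.le)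
    _ = ε := ENNReal.add_halves _

end Partition

/-! ### Lattice properties and existence of the minimal weak upper gradient -/

section WeakUpperGradient

variable {X : Type*} [MetricSpace X] [MeasurableSpace X] [BorelSpace X] {m : Measure X}

theorem IsWeakUpperGradient.congr {f f' : X → ℝ} {G : X → ℝ≥0∞} (hG : IsWeakUpperGradient m f G)
    (hff' : f =ᵐ[m] f') : IsWeakUpperGradient m f' G := by
  refine ⟨hG.1, fun π hπ => ?_⟩
  filter_upwards [hG.2 π hπ, hπ.ae_of_ae 0 hff', hπ.ae_of_ae 1 hff'] with γ h h0 h1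
  rwa [← h0, ← h1]

theorem IsWeakUpperGradient.comp_lipschitz {f : X → ℝ} {G : X → ℝ≥0∞}
    (hG : IsWeakUpperGradient m f G) {φ : ℝ → ℝ} (hφ : LipschitzWith 1 φ) :
    IsWeakUpperGradient m (fun x => φ (f x)) G := by
  refine ⟨hG.1, fun π hπ => ?_⟩
  filter_upwards [hG.2 π hπ] with γ h
  refine ⟨le_trans ?_ h.1, h.2⟩
  simpa using hφ.edist_le_mul (f (γ 1)) (f (γ 0))

/-- Uniform partitions have countably many cells altogether, so a single null set of curves serves
for all of them. -/
theorem IsWeakUpperGradient.ae_edist_gridPoint_le {f : X → ℝ} {G : X → ℝ≥0∞}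
    (hG : IsWeakUpperGradient m f G) {π : Measure C(I, X)} (hπ : IsTestPlan m π) :
    ∀ᵐ γ ∂π, ∀ N k, edist (f (γ (gridPoint N k))) (f (γ (gridPoint N (k + 1))))
      ≤ ∫⁻ t in Icc (gridPoint N k) (gridPoint N (k + 1)), G (γ t) * speed γ t := by
  rw [ae_all_iff]; intro N
  rw [ae_all_iff]; intro k
  -- Cells beyond the end of the interval are degenerate, since `gridPoint` stops at `1`.
  rcases (gridPoint_mono N k.le_succ).eq_or_lt with h | h
  · refine Eventually.of_forall fun γ => ?_
    rw [← Nat.succ_eq_add_one, ← h, edist_self]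
    exact zero_le
  · have hm : Measurable (fun γ : C(I, X) =>
        γ.comp (affineMap (gridPoint N k) (gridPoint N (k + 1)))) :=
      (ContinuousMap.continuous_precomp _).measurable
    filter_upwards [ae_of_ae_map hm.aemeasurable (hG.2 _ (hπ.restrict h))] with γ hγ
    have h1 := hγ.1.trans (lineIntegral_comp_affineMap_le G γ h)
    simpa only [ContinuousMap.comp_apply, affineMap_zero, affineMap_one, edist_comm] using h1

theorem measurable_lineIntegrand {G : X → ℝ≥0∞} (hG : Measurable G) (γ : C(I, X)) :
    Measurable (fun t => G (γ t) * speed γ t) :=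
  (hG.comp γ.continuous.measurable).mul (measurable_speed γ)

/-- The smaller of the two gradients may change along a curve, so the inequalities between the
endpoints do not suffice; those on all cells of fine partitions do. -/
theorem IsWeakUpperGradient.min {f : X → ℝ} {G₁ G₂ : X → ℝ≥0∞} (h₁ : IsWeakUpperGradient m f G₁)
    (h₂ : IsWeakUpperGradient m f G₂) : IsWeakUpperGradient m f (fun x => min (G₁ x) (G₂ x)) := by
  refine ⟨h₁.1.min h₂.1, fun π hπ => ?_⟩
  filter_upwards [h₁.2 π hπ, h₂.2 π hπ, h₁.ae_edist_gridPoint_le hπ, h₂.ae_edist_gridPoint_le hπ]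
    with γ a₁ a₂ b₁ b₂
  have hle := edist_le_lintegral_min (v := fun t => f (γ t)) (measurable_lineIntegrand h₁.1 γ)
    (measurable_lineIntegrand h₂.1 γ) a₁.2.ne a₂.2.ne b₁ b₂
  rw [edist_comm]
  refine ⟨hle.trans (lintegral_mono fun t => le_of_eq ?_),
    lt_of_le_of_lt (lintegral_mono fun t => ?_) a₁.2⟩
  · exact (min_mul_mul_right _ _ _)
  · exact mul_le_mul_left (min_le_left _ _) _

theorem IsWeakUpperGradient.iInf_of_antitone [SecondCountableTopology X] {f : X → ℝ}
    {G : ℕ → X → ℝ≥0∞}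
    (hG : ∀ n, IsWeakUpperGradient m f (G n)) (hanti : Antitone G) :
    IsWeakUpperGradient m f (fun x => ⨅ n, G n x) := by
  refine ⟨Measurable.iInf fun n => (hG n).1, fun π hπ => ?_⟩
  filter_upwards [ae_all_iff.2 fun n => (hG n).2 π hπ, hπ.ae_lintegral_speed_lt_top] with γ h hs
  have heq : lineIntegral (fun x => ⨅ n, G n x) γ = ⨅ n, lineIntegral (G n) γ := by
    simp only [lineIntegral]
    rw [← lintegral_iInf (fun n => measurable_lineIntegrand (hG n).1 γ)
      (fun a b hab t => mul_le_mul_left (hanti hab _) _) (h 0).2.ne]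
    refine lintegral_congr_ae ?_
    filter_upwards [ae_lt_top (measurable_speed γ) hs.ne] with t ht
    -- The infimum commutes with multiplication by the speed because the speed is finite at almost
    -- every time.
    exact ENNReal.iInf_mul fun h' => absurd h' ht.ne
  rw [heq]
  exact ⟨le_iInf fun n => (h n).1, (iInf_le _ 0).trans_lt (h 0).2⟩

/-- Maximize `∫ (1 + G)⁻¹` against a finite measure equivalent to `m`; this functional is finite
even where `G = ∞`. Running minima of a maximizing sequence decrease to a maximizer `Gi`. Replacing
`Gi` by its minimum with a competitor cannot raise the integral, so the two agree almost everywhere.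
-/
theorem exists_isMinimalWeakUpperGradient [SecondCountableTopology X] [SFinite m] {f : X → ℝ}
    {G₀ : X → ℝ≥0∞} (hG₀ : IsWeakUpperGradient m f G₀) :
    ∃ G, IsMinimalWeakUpperGradient m f G := by
  let J : (X → ℝ≥0∞) → ℝ≥0∞ := fun G => ∫⁻ x, (1 + G x)⁻¹ ∂m.toFinite
  have hJle : ∀ G, J G ≤ m.toFinite univ := fun G => by
    refine (lintegral_mono fun x => ?_).trans_eq lintegral_one
    exact ENNReal.inv_le_one.2 le_self_add
  have hJmono : ∀ G G' : X → ℝ≥0∞, G ≤ G' → J G' ≤ J G := fun G G' h =>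
    lintegral_mono fun x => ENNReal.inv_le_inv.2 (add_le_add_right (h x) 1)
  let S := J '' {G | IsWeakUpperGradient m f G}
  have hSne : S.Nonempty := ⟨_, G₀, hG₀, rfl⟩
  obtain ⟨a, -, ha, haS⟩ := exists_seq_tendsto_sSup hSne (OrderTop.bddAbove _)
  choose g hg hga using haS
  let G : ℕ → X → ℝ≥0∞ := fun n => Nat.rec (g 0) (fun k Gk x => min (Gk x) (g (k + 1) x)) n
  have hGs : ∀ k, G (k + 1) = fun x => min (G k x) (g (k + 1) x) := fun k => rfl
  have hGw : ∀ n, IsWeakUpperGradient m f (G n) := by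
    intro n
    induction n with
    | zero => exact hg 0
    | succ k ih => rw [hGs]; exact ih.min (hg (k + 1))
  have hanti : Antitone G := antitone_nat_of_succ_le fun k x => by
    rw [hGs]; exact min_le_left _ _
  have hGg : ∀ n, G n ≤ g n := by
    intro n x
    cases n with
    | zero => exact le_rfl
    | succ k => rw [hGs]; exact min_le_right _ _
  let Gi : X → ℝ≥0∞ := fun x => ⨅ n, G n x
  have hGinf : IsWeakUpperGradient m f Gi := IsWeakUpperGradient.iInf_of_antitone hGw hanti
  have hmax : sSup S ≤ J Gi := by
    refine le_of_tendsto' ha fun n => ?_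
    rw [← hga]
    exact hJmono _ _ fun x => (iInf_le _ n).trans (hGg n x)
  refine ⟨Gi, hGinf, fun G' hG' => ?_⟩
  have hmin := hGinf.min hG'
  have hle : J (fun x => min (Gi x) (G' x)) ≤ J Gi :=
    (le_sSup (mem_image_of_mem J hmin)).trans hmax
  have hae : (fun x => (1 + Gi x)⁻¹) =ᵐ[m.toFinite] fun x => (1 + min (Gi x) (G' x))⁻¹ := by
    refine ae_eq_of_ae_le_of_lintegral_le (Eventually.of_forall fun x => ?_) ?_ ?_ hle
    · exact ENNReal.inv_le_inv.2 (add_le_add_right (min_le_left _ _) 1)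
    · exact ne_top_of_le_ne_top (measure_ne_top _ _) (hJle _)
    · exact ((hmin.1.const_add 1).inv).aemeasurable
  filter_upwards [(absolutelyContinuous_toFinite m).ae_le hae] with x hx
  have h1 := inv_injective hx
  have h2 : Gi x = Min.min (Gi x) (G' x) := (ENNReal.add_right_inj ENNReal.one_ne_top).1 h1
  exact h2.le.trans (min_le_right _ _)

theorem isMinimalWeakUpperGradient_minWeakUpperGradient [SecondCountableTopology X] [SFinite m]
    {f : X → ℝ} {G₀ : X → ℝ≥0∞} (hG₀ : IsWeakUpperGradient m f G₀) :
    IsMinimalWeakUpperGradient m f (minWeakUpperGradient m f) := by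
  have h := exists_isMinimalWeakUpperGradient hG₀
  rw [minWeakUpperGradient, dif_pos h]
  exact h.choose_spec

end WeakUpperGradient

/-! ### The local Lipschitz constant as a weak upper gradient -/

section LipUpperGradient

theorem lip_le_of_eventually {X Y : Type*} [MetricSpace X] [PseudoEMetricSpace Y] {f : X → Y}
    {x : X} {c : ℝ≥0∞} (h : ∀ᶠ y in 𝓝[≠] x, edist (f y) (f x) ≤ c * edist y x) : lip f x ≤ c :=
  limsup_le_of_le (h := h.mono fun _ hy => ENNReal.div_le_of_le_mul hy)

theorem eventually_edist_le_of_lip_lt {X Y : Type*} [MetricSpace X] [PseudoEMetricSpace Y]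
    {f : X → Y} {x : X} {c : ℝ≥0∞} (h : lip f x < c) :
    ∀ᶠ y in 𝓝 x, edist (f y) (f x) ≤ c * edist y x := by
  have h1 : ∀ᶠ y in 𝓝[≠] x, edist (f y) (f x) / edist y x < c := eventually_lt_of_limsup_lt h
  rw [eventually_nhdsWithin_iff] at h1
  filter_upwards [h1] with y hy
  by_cases hyx : y = x
  · simp [hyx]
  · have hpos : edist y x ≠ 0 := by rwa [Ne, edist_eq_zero]
    exact (ENNReal.div_le_iff hpos (edist_ne_top _ _)).1 (hy hyx).le

/-- Finiteness of both factors excludes the product `0 · ∞`, for which the chain rule can fail. -/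
theorem lip_comp_le {X Y Z : Type*} [MetricSpace X] [MetricSpace Y] [PseudoEMetricSpace Z]
    {f : Y → Z} {g : X → Y} {x : X} (hg : ContinuousAt g x) (hf' : lip f (g x) ≠ ∞)
    (hg' : lip g x ≠ ∞) : lip (fun y => f (g y)) x ≤ lip f (g x) * lip g x := by
  refine ENNReal.le_mul_of_forall_lt (Or.inr hg') (Or.inl hf') fun a ha b hb => ?_
  refine lip_le_of_eventually (Eventually.filter_mono nhdsWithin_le_nhds ?_)
  filter_upwards [hg.eventually (eventually_edist_le_of_lip_lt ha),
    eventually_edist_le_of_lip_lt hb] with y h1 h2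
  rw [mul_assoc]
  exact h1.trans (mul_le_mul_right h2 _)

/-- Functions that are Lipschitz on bounded sets. -/
def IsLipschitzOnBounded {X : Type*} [MetricSpace X] (u : X → ℝ) : Prop :=
  ∀ B : Set X, Bornology.IsBounded B → ∃ C : ℝ≥0, LipschitzOnWith C u B

variable {X : Type*} [MetricSpace X]

theorem IsLipschitzOnBounded.continuous {u : X → ℝ} (hu : IsLipschitzOnBounded u) :
    Continuous u := by
  refine continuous_iff_continuousAt.2 fun x => ?_
  obtain ⟨C, hC⟩ := hu _ (Metric.isBounded_ball (x := x) (r := 1))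
  exact hC.continuousOn.continuousAt (Metric.ball_mem_nhds x one_pos)

theorem lip_le_of_lipschitzOnWith {u : X → ℝ} {C : ℝ≥0} {s : Set X} (hu : LipschitzOnWith C u s)
    {x : X} (hx : s ∈ 𝓝 x) : lip u x ≤ C := by
  refine lip_le_of_eventually (Eventually.filter_mono nhdsWithin_le_nhds ?_)
  filter_upwards [hx] with y hy using hu hy (mem_of_mem_nhds hx)

theorem enorm_deriv_le_lip {v : I → ℝ} {τ : I} :
    ‖deriv (fun x : ℝ => v (projIcc 0 1 zero_le_one x)) τ‖ₑ ≤ lip v τ := by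
  set w : ℝ → ℝ := fun x => v (projIcc 0 1 zero_le_one x) with hw
  by_cases hd : DifferentiableAt ℝ w τ
  swap
  · rw [deriv_zero_of_not_differentiableAt hd]; simp
  have h1 : Tendsto (slope w τ) (𝓝[≠] (τ : ℝ)) (𝓝 (deriv w τ)) := hd.hasDerivAt.tendsto_slope
  have h2 : Tendsto (Subtype.val : I → ℝ) (𝓝[≠] τ) (𝓝[≠] (τ : ℝ)) := by
    refine tendsto_nhdsWithin_iff.2
      ⟨continuous_subtype_val.continuousAt.tendsto.mono_left nhdsWithin_le_nhds, ?_⟩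
    filter_upwards [self_mem_nhdsWithin] with y hy
    exact fun h => hy (Subtype.ext h)
  have h3 : Tendsto (fun y : I => edist (v y) (v τ) / edist y τ) (𝓝[≠] τ) (𝓝 ‖deriv w τ‖ₑ) := by
    refine ((continuous_enorm.tendsto _).comp (h1.comp h2)).congr' ?_
    filter_upwards [self_mem_nhdsWithin] with y hy
    have hne : (y : ℝ) - τ ≠ 0 := sub_ne_zero.2 fun h => hy (Subtype.ext h)
    simp only [Function.comp_apply, slope_def_field, hw, projIcc_val]
    rw [div_eq_mul_inv, enorm_mul, enorm_inv hne, edist_eq_enorm_sub, ← div_eq_mul_inv,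
      Subtype.edist_eq, edist_eq_enorm_sub]
  have : (𝓝[≠] τ).NeBot := inferInstance
  exact h3.limsup_eq.ge

/-- Increments of `u ∘ γ` are at most `C` times those of a primitive of the integrable function `g`,
and such a primitive is absolutely continuous. -/
theorem IsACCurve.absolutelyContinuous_comp {γ : C(I, X)} (hγ : IsACCurve γ) {u : X → ℝ}
    {C : ℝ≥0} (hu : LipschitzOnWith C u (range γ)) :
    AbsolutelyContinuousOnInterval (fun x : ℝ => u (γ (projIcc 0 1 zero_le_one x))) 0 1 := by
  obtain ⟨g, hgm, hg2, hg⟩ := hγ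
  have hg1 : ∫⁻ τ, g τ < ∞ := by
    refine lt_of_le_of_lt (b := ∫⁻ t, (1 + g t ^ 2)) (lintegral_mono fun t => ?_) ?_
    · rcases le_total (g t) 1 with h | h
      · exact h.trans le_self_add
      · exact (le_self_pow₀ h two_ne_zero).trans le_add_self
    · rw [lintegral_add_left measurable_const]
      simpa using hg2
  set G : ℝ → ℝ := fun x => (g (projIcc 0 1 zero_le_one x)).toReal with hG
  have hgm' : Measurable (fun x : ℝ => g (projIcc 0 1 zero_le_one x)) :=
    hgm.comp continuous_projIcc.measurable
  have hfin : ∫⁻ x in Icc (0 : ℝ) 1, g (projIcc 0 1 zero_le_one x) ≠ ∞ := by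
    rw [← lintegral_unitInterval]; exact hg1.ne
  have hGi : IntegrableOn G (Icc 0 1) :=
    integrable_toReal_of_lintegral_ne_top hgm'.aemeasurable hfin
  have hGint : IntervalIntegrable G volume 0 1 :=
    (intervalIntegrable_iff_integrableOn_Icc_of_le zero_le_one).2 hGi
  have hac := hGint.absolutelyContinuousOnInterval_intervalIntegral (c := 0) (by simp)
  have key : ∀ s ∈ Icc (0 : ℝ) 1, ∀ t ∈ Icc (0 : ℝ) 1, s ≤ t →
      dist (u (γ (projIcc 0 1 zero_le_one s))) (u (γ (projIcc 0 1 zero_le_one t))) ≤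
        C * dist (∫ x in (0 : ℝ)..s, G x) (∫ x in (0 : ℝ)..t, G x) := by
    intro s hs t ht hst
    refine (hu.dist_le_mul _ (mem_range_self _) _ (mem_range_self _)).trans
      (mul_le_mul_of_nonneg_left ?_ C.2)
    have hIs : IntervalIntegrable G volume 0 s := hGint.mono_set (by
      rw [uIcc_of_le hs.1, uIcc_of_le zero_le_one]; exact Icc_subset_Icc le_rfl hs.2)
    have hIt : IntervalIntegrable G volume 0 t := hGint.mono_set (by
      rw [uIcc_of_le ht.1, uIcc_of_le zero_le_one]; exact Icc_subset_Icc le_rfl ht.2)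
    rw [dist_comm (∫ x in (0 : ℝ)..s, G x), Real.dist_eq,
      intervalIntegral.integral_interval_sub_left hIt hIs]
    refine le_trans ?_ (le_abs_self _)
    have h1 := hg (projIcc 0 1 zero_le_one s) (projIcc 0 1 zero_le_one t) (monotone_projIcc _ hst)
    rw [setLIntegral_unitInterval, edist_dist] at h1
    rw [projIcc_of_mem _ hs, projIcc_of_mem _ ht] at h1 ⊢
    have hle : ∫⁻ x in Icc s t, g (projIcc 0 1 zero_le_one x) ≠ ∞ :=
      ne_top_of_le_ne_top hfin (lintegral_mono_set (Icc_subset_Icc hs.1 ht.2))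
    have h2 := (ENNReal.ofReal_le_iff_le_toReal hle).1 h1
    rw [intervalIntegral.integral_of_le hst, ← integral_Icc_eq_integral_Ioc,
      integral_toReal hgm'.aemeasurable.restrict (ae_lt_top hgm' hle)]
    exact h2
  refine hac.of_dist_le (C := C) fun s hs t ht => ?_
  rw [uIcc_of_le zero_le_one] at hs ht
  rcases le_total s t with h | h
  · exact key s hs t ht h
  · rw [dist_comm, dist_comm (∫ x in (0 : ℝ)..s, G x)]
    exact key t ht s hs h

variable [MeasurableSpace X] [BorelSpace X] [SecondCountableTopology X] {m : Measure X}

/-- The local Lipschitz constant of a function that is Lipschitz on bounded sets is a weak upper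
gradient. -/
theorem IsLipschitzOnBounded.isWeakUpperGradient_lip {u : X → ℝ} (hu : IsLipschitzOnBounded u) :
    IsWeakUpperGradient m u (lip u) := by
  refine ⟨measurable_lip hu.continuous, fun π hπ => ?_⟩
  filter_upwards [hπ.ac, hπ.ae_lintegral_speed_lt_top] with γ hγ hs
  -- A Lipschitz bound on the curve alone does not control `lip u`, which looks at a full
  -- neighbourhood; a bounded open neighbourhood of the compact image does.
  have hbdd : Bornology.IsBounded (Metric.thickening 1 (range γ)) :=
    (isCompact_range γ.continuous).isBounded.thickening
  obtain ⟨C, hC⟩ := hu _ hbdd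
  have hCr : LipschitzOnWith C u (range γ) := hC.mono (Metric.self_subset_thickening one_pos _)
  have hlip : ∀ t, lip u (γ t) ≤ C := fun t => lip_le_of_lipschitzOnWith hC
    (Metric.isOpen_thickening.mem_nhds
      (Metric.self_subset_thickening one_pos _ (mem_range_self t)))
  constructor
  · have hac := hγ.absolutelyContinuous_comp hCr
    set w : ℝ → ℝ := fun x => u (γ (projIcc 0 1 zero_le_one x)) with hw
    have h1 : w 1 - w 0 = u (γ 1) - u (γ 0) := by
      have e1 : projIcc 0 1 zero_le_one (1 : ℝ) = (1 : I) := projIcc_right (zero_le_one' ℝ)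
      have e0 : projIcc 0 1 zero_le_one (0 : ℝ) = (0 : I) := projIcc_left (zero_le_one' ℝ)
      simp only [hw, e0, e1]
    rw [edist_eq_enorm_sub, ← h1, ← hac.integral_deriv_eq_sub,
      intervalIntegral.integral_of_le zero_le_one, ← integral_Icc_eq_integral_Ioc, lineIntegral]
    refine (enorm_integral_le_lintegral_enorm _).trans ?_
    have h2 : ∫⁻ x in Icc (0 : ℝ) 1, ‖deriv w x‖ₑ
        = ∫⁻ τ : I, ‖deriv w τ‖ₑ := by
      rw [lintegral_unitInterval]
      exact setLIntegral_congr_fun measurableSet_Icc fun x hx => by rw [projIcc_of_mem _ hx]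
    rw [h2]
    refine lintegral_mono_ae ?_
    filter_upwards [ae_lt_top (measurable_speed γ) hs.ne] with τ hτ
    refine (enorm_deriv_le_lip (v := fun t => u (γ t))).trans ?_
    exact lip_comp_le γ.continuous.continuousAt (ne_top_of_le_ne_top ENNReal.coe_ne_top (hlip τ))
      hτ.ne
  · refine lt_of_le_of_lt (b := ∫⁻ t, C * speed γ t)
      (lintegral_mono fun t => mul_le_mul_left (hlip t) _) ?_
    rw [lintegral_const_mul _ (measurable_speed γ)]
    exact ENNReal.mul_lt_top ENNReal.coe_lt_top hs

end LipUpperGradient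

/-! ### An `L¹` bound for the heat flow by truncation -/

section HeatFlow

/-- Truncation of a real number to `[-1, 1]`. -/
noncomputable def clamp (x : ℝ) : ℝ := max (-1) (min x 1)

theorem lipschitzWith_clamp : LipschitzWith 1 clamp :=
  (LipschitzWith.id.min_const 1).const_max (-1)

theorem clamp_zero : clamp 0 = 0 := by simp [clamp]

theorem lipschitzWith_sub_clamp : LipschitzWith 1 (fun x => x - clamp x) := by
  refine LipschitzWith.of_dist_le_mul fun x y => ?_
  simp only [clamp, Real.dist_eq, NNReal.coe_one, one_mul]
  grind

theorem clamp_variational (x y : ℝ) : (x - clamp x) * (clamp y - clamp x) ≤ 0 := by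
  simp only [clamp]
  rcases le_total x 1 with h1 | h1 <;> rcases le_total y 1 with h2 | h2 <;>
  rcases le_total x (-1) with h3 | h3 <;> rcases le_total y (-1) with h4 | h4 <;>
  simp [*] <;> nlinarith

variable {X : Type*} [MetricSpace X] [MeasurableSpace X] {m : Measure X}

/-- Truncation to `[-1, 1]` on `L²`. -/
noncomputable def clampLp (m : Measure X) (u : Lp ℝ 2 m) : Lp ℝ 2 m :=
  lipschitzWith_clamp.compLp clamp_zero u

theorem coeFn_clampLp (u : Lp ℝ 2 m) : clampLp m u =ᵐ[m] fun x => clamp (u x) :=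
  lipschitzWith_clamp.coeFn_compLp clamp_zero u

theorem coeFn_sub_clampLp (u : Lp ℝ 2 m) :
    (u - clampLp m u : Lp ℝ 2 m) =ᵐ[m] fun x => u x - clamp (u x) := by
  filter_upwards [Lp.coeFn_sub u (clampLp m u), coeFn_clampLp u] with x h1 h2
  rw [h1, Pi.sub_apply, h2]

theorem clampLp_variational (u v : Lp ℝ 2 m) :
    inner ℝ (u - clampLp m u) (clampLp m v - clampLp m u) ≤ 0 := by
  rw [L2.inner_def]
  refine integral_nonpos_of_ae ?_
  filter_upwards [coeFn_sub_clampLp u, coeFn_clampLp u, coeFn_clampLp v,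
    Lp.coeFn_sub (clampLp m v) (clampLp m u)] with x h1 h2 h3 h4
  rw [h1, h4, Pi.sub_apply, h2, h3]
  simpa [mul_comm] using clamp_variational (u x) (v x)

theorem norm_clampLp_le (u : Lp ℝ 2 m) : ‖clampLp m u‖ ≤ ‖u‖ := by
  simpa [clampLp] using lipschitzWith_clamp.norm_compLp_le clamp_zero u

/-- The integrand is the Huber function, `x² / 2` on `[-1, 1]` and `|x| - 1/2` outside. It lies
between `|x| - 1` and `|x|`, so a bound on it controls the `L¹` norm on sets of finite measure. -/
theorem envelope_clampLp (u : Lp ℝ 2 m) :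
    ENNReal.ofReal (envelope (clampLp m) u) =
      ∫⁻ x, ENNReal.ofReal (2⁻¹ * u x ^ 2 - 2⁻¹ * (u x - clamp (u x)) ^ 2) ∂m := by
  have hsq : ∀ w : Lp ℝ 2 m, ‖w‖ ^ 2 = ∫ x, w x ^ 2 ∂m := fun w => by
    rw [← real_inner_self_eq_norm_sq, L2.inner_def]
    refine integral_congr_ae (Eventually.of_forall fun x => ?_)
    simp [sq]
  have hi : ∀ w : Lp ℝ 2 m, Integrable (fun x => w x ^ 2) m := fun w =>
    (Lp.memLp w).integrable_sq
  have hi2 : Integrable (fun x => (u x - clamp (u x)) ^ 2) m :=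
    (hi (u - clampLp m u)).congr ((coeFn_sub_clampLp u).mono fun x hx => by simp only [hx])
  have h2 : ‖u - clampLp m u‖ ^ 2 = ∫ x, (u x - clamp (u x)) ^ 2 ∂m := by
    rw [hsq]
    exact integral_congr_ae ((coeFn_sub_clampLp u).mono fun x hx => by simp only [hx])
  have hint : Integrable (fun x => 2⁻¹ * u x ^ 2 - 2⁻¹ * (u x - clamp (u x)) ^ 2) m :=
    ((hi u).const_mul _).sub (hi2.const_mul _)
  rw [envelope, h2, hsq, ← integral_const_mul, ← integral_const_mul,
    ← integral_sub ((hi u).const_mul _) (hi2.const_mul _),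
    ofReal_integral_eq_lintegral_ofReal hint]
  refine Eventually.of_forall fun x => ?_
  simp only [Pi.zero_apply, clamp]
  rcases le_total (u x) 1 with h1 | h1 <;> rcases le_total (u x) (-1) with h3 | h3 <;>
    simp [h1, h3] <;> nlinarith

theorem envelope_clampLp_le (u : Lp ℝ 2 m) :
    ENNReal.ofReal (envelope (clampLp m) u) ≤ ∫⁻ x, ‖u x‖ₑ ∂m := by
  rw [envelope_clampLp]
  refine lintegral_mono fun x => ?_
  rw [← ofReal_norm]
  refine ENNReal.ofReal_le_ofReal ?_
  simp only [clamp, Real.norm_eq_abs]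
  rcases le_total (u x) 1 with h1 | h1 <;> rcases le_total (u x) (-1) with h3 | h3 <;>
    rcases le_total (u x) 0 with h4 | h4 <;>
    simp [h1, h3, abs_of_nonneg, abs_of_nonpos, h4] <;> nlinarith

theorem setLIntegral_enorm_le_envelope (u : Lp ℝ 2 m) (B : Set X) :
    ∫⁻ x in B, ‖u x‖ₑ ∂m ≤ ENNReal.ofReal (envelope (clampLp m) u) + m B := by
  have hpt : ∀ x, ‖u x‖ₑ ≤
      ENNReal.ofReal (2⁻¹ * u x ^ 2 - 2⁻¹ * (u x - clamp (u x)) ^ 2) + 1 := fun x => by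
    rw [← ofReal_norm, ← ENNReal.ofReal_one]
    refine le_trans (ENNReal.ofReal_le_ofReal ?_) ENNReal.ofReal_add_le
    simp only [clamp, Real.norm_eq_abs]
    rcases le_total (u x) 1 with h1 | h1 <;> rcases le_total (u x) (-1) with h3 | h3 <;>
      rcases le_total (u x) 0 with h4 | h4 <;>
      simp [h1, h3, abs_of_nonneg, abs_of_nonpos, h4] <;> nlinarith
  calc ∫⁻ x in B, ‖u x‖ₑ ∂m
      ≤ ∫⁻ x in B, (ENNReal.ofReal (2⁻¹ * u x ^ 2 - 2⁻¹ * (u x - clamp (u x)) ^ 2) + 1) ∂m :=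
        lintegral_mono fun x => hpt x
    _ = ∫⁻ x in B, ENNReal.ofReal (2⁻¹ * u x ^ 2 - 2⁻¹ * (u x - clamp (u x)) ^ 2) ∂m + m B := by
        rw [lintegral_add_right _ measurable_const]; simp
    _ ≤ _ := by
        rw [envelope_clampLp]
        exact add_le_add_left (setLIntegral_le_lintegral _ _) _

variable [BorelSpace X] [SecondCountableTopology X] [SFinite m]

/-- Since `x ↦ x - clamp x` is `1`-Lipschitz, every weak upper gradient of `u` is one of `u -
clampLp m u`. -/
theorem cheegerEnergy_sub_clampLp_le (u : Lp ℝ 2 m) :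
    cheegerEnergy m (u - clampLp m u) ≤ cheegerEnergy m u := by
  by_cases h : ∃ G, IsMinimalWeakUpperGradient m u G
  · have hG : IsMinimalWeakUpperGradient m u (minWeakUpperGradient m u) := by
      obtain ⟨G, hG⟩ := h
      exact isMinimalWeakUpperGradient_minWeakUpperGradient hG.1
    have hw : IsWeakUpperGradient m (u - clampLp m u : Lp ℝ 2 m) (minWeakUpperGradient m u) :=
      (hG.1.comp_lipschitz lipschitzWith_sub_clamp).congr (coeFn_sub_clampLp u).symm
    have hmin := (isMinimalWeakUpperGradient_minWeakUpperGradient hw).2 _ hw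
    refine mul_le_mul_right (lintegral_mono_ae ?_) _
    filter_upwards [hmin] with x hx using pow_le_pow_left' hx 2
  -- Without a minimal gradient the convention assigns the value `∞`, whose integral is `∞` unless
  -- `m = 0`.
  · by_cases hm : m = 0
    · simp [cheegerEnergy, hm]
    · have : cheegerEnergy m u = ∞ := by
        rw [cheegerEnergy, minWeakUpperGradient, dif_neg h]
        simp [ENNReal.top_mul, hm]
      rw [this]; exact le_top

theorem setLIntegral_heatFlow_le {t : ℝ} (ht : 0 < t) (f : Lp ℝ 2 m) (B : Set X) :
    ∫⁻ x in B, ‖heatFlow m t f x‖ₑ ∂m ≤ ∫⁻ x, ‖f x‖ₑ ∂m + m B := by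
  by_cases h : ∃ u, IsGradientFlow (cheegerEnergy m) f u
  · rw [heatFlow, dif_pos h]
    have h1 := h.choose_spec.envelope_le clampLp_variational norm_clampLp_le
      cheegerEnergy_sub_clampLp_le ht
    refine (setLIntegral_enorm_le_envelope _ B).trans (add_le_add_left ?_ _)
    exact (ENNReal.ofReal_le_ofReal h1).trans (envelope_clampLp_le f)
  -- If there were no flow, `heatFlow` would be `0` by convention and the bound trivial; existence
  -- of the flow is thus not needed.
  · rw [heatFlow, dif_neg h]
    have : ∫⁻ x in B, ‖(0 : Lp ℝ 2 m) x‖ₑ ∂m = 0 := by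
      rw [lintegral_congr_ae (g := fun _ => 0)]
      · simp
      · refine ae_restrict_of_ae ?_
        filter_upwards [Lp.coeFn_zero ℝ 2 m] with x hx
        rw [hx]
        simp
    rw [this]; exact zero_le

end HeatFlow

/-! ### Kernel measures and finiteness of one moment -/

section Kernel

variable {X : Type*} [MetricSpace X] [MeasurableSpace X] {m : Measure X} {r : ℝ → X → X → ℝ}

/-- The probability measure `r_t[x] m`. -/
noncomputable def kernelMeasure (m : Measure X) (r : ℝ → X → X → ℝ) (t : ℝ) (x : X) : Measure X :=
  m.withDensity fun y => ENNReal.ofReal (r t x y)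

theorem IsHeatKernel.aemeasurable_density (hr : IsHeatKernel m r) {t : ℝ} (ht : 0 < t) (x : X) :
    AEMeasurable (fun y => ENNReal.ofReal (r t x y)) m :=
  (hr.integrable t ht x).aestronglyMeasurable.aemeasurable.ennreal_ofReal

theorem IsHeatKernel.isProbabilityMeasure (hr : IsHeatKernel m r) {t : ℝ} (ht : 0 < t) (x : X) :
    IsProbabilityMeasure (kernelMeasure m r t x) := by
  refine ⟨?_⟩
  rw [kernelMeasure, withDensity_apply _ MeasurableSet.univ, Measure.restrict_univ,
    ← ofReal_integral_eq_lintegral_ofReal (hr.integrable t ht x)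
      (Eventually.of_forall fun y => (hr.pos t ht x y).le), hr.integral_eq_one t ht x,
    ENNReal.ofReal_one]

theorem kernelMeasure_absolutelyContinuous (t : ℝ) (x : X) : kernelMeasure m r t x ≪ m :=
  withDensity_absolutelyContinuous _ _

theorem IsHeatKernel.absolutelyContinuous (hr : IsHeatKernel m r) {t : ℝ} (ht : 0 < t) (x : X) :
    m ≪ kernelMeasure m r t x :=
  withDensity_absolutelyContinuous' (hr.aemeasurable_density ht x)
    (Eventually.of_forall fun y => by simpa using hr.pos t ht x y)

theorem IsHeatKernel.integral_kernelMeasure (hr : IsHeatKernel m r) {t : ℝ} (ht : 0 < t) (x : X)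
    (f : X → ℝ) : ∫ y, f y ∂kernelMeasure m r t x = kernelFlow m r t f x := by
  rw [kernelMeasure, integral_withDensity_eq_integral_toReal_smul₀ (hr.aemeasurable_density ht x)
    (Eventually.of_forall fun y => ENNReal.ofReal_lt_top), kernelFlow]
  refine integral_congr_ae (Eventually.of_forall fun y => ?_)
  simp only [smul_eq_mul]
  rw [ENNReal.toReal_ofReal (hr.pos t ht x y).le, mul_comm]

theorem IsHeatKernel.integrable_kernelMeasure_iff (hr : IsHeatKernel m r) {t : ℝ} (ht : 0 < t)
    (x : X) (f : X → ℝ) :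
    Integrable f (kernelMeasure m r t x) ↔ Integrable (fun y => f y * r t x y) m := by
  rw [kernelMeasure, integrable_withDensity_iff_integrable_smul₀' (hr.aemeasurable_density ht x)
    (Eventually.of_forall fun y => ENNReal.ofReal_lt_top)]
  refine integrable_congr (Eventually.of_forall fun y => ?_)
  simp only [smul_eq_mul]
  rw [ENNReal.toReal_ofReal (hr.pos t ht x y).le, mul_comm]

variable [BorelSpace X] [SecondCountableTopology X] [SFinite m]

/-- The heat kernel does not increase the `L¹` norm by more than the measure of the set on which it
is computed. -/
theorem IsHeatKernel.setLIntegral_lintegral_le (hr : IsHeatKernel m r) {t : ℝ} (ht : 0 < t)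
    {F : X → ℝ≥0} (hF : Measurable F) (hFi : ∫⁻ x, F x ∂m ≠ ∞) (B : Set X) :
    ∫⁻ x in B, ∫⁻ y, F y ∂kernelMeasure m r t x ∂m ≤ ∫⁻ x, F x ∂m + m B := by
  -- The truncations of an integrable function lie in `L²`, where the kernel represents the flow;
  -- monotone convergence removes the truncation.
  let f : ℕ → X → ℝ := fun n x => (min (F x) n : ℝ≥0)
  have hfm : ∀ n, Measurable (f n) := fun n => (hF.min measurable_const).coe_nnreal_real
  have hf1 : ∀ n, MemLp (f n) 1 m := fun n => by
    refine memLp_one_iff_integrable.2 ⟨(hfm n).aestronglyMeasurable, ?_⟩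
    refine lt_of_le_of_lt (lintegral_mono fun x => ?_) hFi.lt_top
    simp only [f, NNReal.enorm_eq]
    exact_mod_cast min_le_left _ _
  have hf2 : ∀ n, MemLp (f n) 2 m := fun n => by
    rw [memLp_two_iff_integrable_sq (hfm n).aestronglyMeasurable]
    refine ((memLp_one_iff_integrable.1 (hf1 n)).const_mul (n : ℝ)).mono'
      ((hfm n).pow_const 2).aestronglyMeasurable (Eventually.of_forall fun x => ?_)
    have h0 : 0 ≤ f n x := NNReal.coe_nonneg _
    have h1 : f n x ≤ n := by simp only [f]; exact_mod_cast min_le_right _ _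
    rw [Real.norm_of_nonneg (by positivity), sq]
    exact mul_le_mul_of_nonneg_right h1 h0
  have hker : ∀ n x, ‖kernelFlow m r t (f n) x‖ₑ
      = ∫⁻ y, (min (F y) n : ℝ≥0) ∂kernelMeasure m r t x := fun n x => by
    have := hr.isProbabilityMeasure ht x
    rw [← hr.integral_kernelMeasure ht]
    have hi : Integrable (f n) (kernelMeasure m r t x) :=
      (memLp_top_of_bound (hfm n).aestronglyMeasurable n (Eventually.of_forall fun x => by
        simp only [f, NNReal.norm_eq]; exact_mod_cast min_le_right _ _)).integrable le_top
    rw [← ofReal_norm, Real.norm_of_nonneg (integral_nonneg fun y => NNReal.coe_nonneg _),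
      ofReal_integral_eq_lintegral_ofReal hi (Eventually.of_forall fun y => NNReal.coe_nonneg _)]
    simp [f]
  have hheat : ∀ n, (fun x => ‖heatFlow m t ((hf2 n).toLp _) x‖ₑ) =ᵐ[m]
      fun x => ∫⁻ y, (min (F y) n : ℝ≥0) ∂kernelMeasure m r t x := fun n => by
    filter_upwards [hr.represents t ht ((hf2 n).toLp _)] with x hx
    rw [hx, ← hker]
    congr 1
    refine integral_congr_ae ?_
    filter_upwards [(hf2 n).coeFn_toLp] with y hy
    rw [hy]
  have hsup : ∀ x, ∫⁻ y, F y ∂kernelMeasure m r t x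
      = ⨆ n : ℕ, ∫⁻ y, (min (F y) n : ℝ≥0) ∂kernelMeasure m r t x := fun x => by
    rw [← lintegral_iSup (fun n => (hF.min measurable_const).coe_nnreal_ennreal)
      (fun a b hab y => by gcongr)]
    refine lintegral_congr fun y => ?_
    refine le_antisymm ?_ (iSup_le fun n => by gcongr; exact min_le_left _ _)
    obtain ⟨n, hn⟩ := exists_nat_ge (F y)
    exact le_iSup_of_le n (by rw [min_eq_left hn])
  simp only [hsup]
  rw [lintegral_iSup' ?_ ?_]
  · refine iSup_le fun n => ?_
    rw [← lintegral_congr_ae (ae_restrict_of_ae (hheat n))]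
    refine (setLIntegral_heatFlow_le ht _ B).trans (add_le_add_left ?_ _)
    rw [lintegral_congr_ae (g := fun x => ‖f n x‖ₑ)
      ((hf2 n).coeFn_toLp.mono fun x hx => by simp only [hx])]
    refine lintegral_mono fun x => ?_
    simp only [f, NNReal.enorm_eq]
    exact_mod_cast min_le_left _ _
  -- Measurability in `x` is inherited from the heat flow, which equals the kernel integral almost
  -- everywhere; `r` is not assumed jointly measurable.
  · intro n
    exact ((Lp.stronglyMeasurable _).measurable.enorm.aemeasurable.congr (hheat n)).restrict
  · refine Eventually.of_forall fun x a b hab => lintegral_mono fun y => ?_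
    gcongr

/-- If the integral were infinite at every point, the previous bound on balls would make all of them
null. Then `m = 0`, which carries no probability density. -/
theorem IsHeatKernel.exists_lintegral_ne_top (hr : IsHeatKernel m r) {t : ℝ} (ht : 0 < t)
    {F : X → ℝ≥0} (hF : Measurable F) (hFi : ∫⁻ x, F x ∂m ≠ ∞)
    (hm : ∀ s : Set X, Bornology.IsBounded s → m s < ∞) (x₀ : X) :
    ∃ y, ∫⁻ z, F z ∂kernelMeasure m r t y ≠ ∞ := by
  by_contra! hcon
  have hball : ∀ n : ℕ, m (Metric.ball x₀ n) = 0 := fun n => by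
    have h1 := hr.setLIntegral_lintegral_le ht hF hFi (Metric.ball x₀ n)
    simp only [hcon, setLIntegral_const] at h1
    by_contra h0
    rw [ENNReal.top_mul h0, top_le_iff] at h1
    exact (ENNReal.add_lt_top.2 ⟨hFi.lt_top, hm _ Metric.isBounded_ball⟩).ne h1
  have huniv : m univ = 0 := by
    rw [← Metric.iUnion_ball_nat x₀]
    exact measure_iUnion_null hball
  have := hr.integral_eq_one t ht x₀
  rw [Measure.measure_univ_eq_zero.1 huniv] at this
  simp at this

end Kernel

/-! ### Log-moments under the Harnack inequality -/

section Harnack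

variable {X : Type*} [MetricSpace X] [MeasurableSpace X]

/-- A family of mutually absolutely continuous probability measures satisfying the dimension-free
Harnack inequality. -/
structure HarnackFamily (μ : X → Measure X) (κ : ℝ) : Prop where
  prob : ∀ x, IsProbabilityMeasure (μ x)
  ac : ∀ x y, μ x ≪ μ y
  pos : 0 < κ
  harnack : ∀ p : ℝ, 1 < p → ∀ F : X → ℝ≥0, Measurable F → ∀ x y,
    (∫⁻ z, F z ∂μ x) ^ p ≤ (∫⁻ z, (F z : ℝ≥0∞) ^ p ∂μ y) *
      ENNReal.ofReal (Real.exp (p * κ * dist x y ^ 2 / (4 * (p - 1))))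

/-- The moment `∫ F ^ p dμ_x`. -/
noncomputable def moment (μ : X → Measure X) (F : X → ℝ≥0) (p : ℝ) (x : X) : ℝ≥0∞ :=
  ∫⁻ z, (F z : ℝ≥0∞) ^ p ∂μ x

/-- The logarithm of the moment `∫ F ^ p dμ_x`. -/
noncomputable def logMoment (μ : X → Measure X) (F : X → ℝ≥0) (p : ℝ) (x : X) : ℝ :=
  Real.log (moment μ F p x).toReal

variable {μ : X → Measure X} {κ : ℝ} {F : X → ℝ≥0}

theorem moment_one (x : X) : moment μ F 1 x = ∫⁻ z, F z ∂μ x := by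
  simp [moment]

theorem HarnackFamily.moment_ne_zero (hμ : HarnackFamily μ κ) (hF : Measurable F) {w : X}
    (h0 : moment μ F 1 w ≠ 0) (p : ℝ) (x : X) : moment μ F p x ≠ 0 := by
  contrapose! h0
  rw [moment, lintegral_eq_zero_iff (hF.coe_nnreal_ennreal.pow_const p)] at h0
  rw [moment, lintegral_eq_zero_iff (hF.coe_nnreal_ennreal.pow_const 1)]
  filter_upwards [(hμ.ac w x).ae_le h0] with z hz
  simp only [Pi.zero_apply, ENNReal.rpow_eq_zero_iff, ENNReal.coe_ne_top, false_and, or_false]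
    at hz ⊢
  exact ⟨hz.1, one_pos⟩

theorem HarnackFamily.moment_rpow_le (hμ : HarnackFamily μ κ) (hF : Measurable F) {p s : ℝ}
    (hp : 0 < p) (hs : 1 < s) (x y : X) :
    moment μ F p x ^ s ≤ moment μ F (p * s) y *
      ENNReal.ofReal (Real.exp (s * κ * dist x y ^ 2 / (4 * (s - 1)))) := by
  have h := hμ.harnack s hs (fun z => F z ^ p) (hF.pow_const p) x y
  simp only [ENNReal.coe_rpow_of_nonneg _ hp.le, ← ENNReal.rpow_mul] at h
  exact h

/-- Harnack with exponent `p₀ / p`, applied to `F ^ p`, bounds the moment at `x` by the one of order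
`p₀` at `y₀`. -/
theorem HarnackFamily.moment_ne_top (hμ : HarnackFamily μ κ) (hF : Measurable F) {p₀ : ℝ} {y₀ : X}
    (hfin : moment μ F p₀ y₀ ≠ ∞) {p : ℝ} (hp : 0 < p) (hpp : p < p₀) (x : X) :
    moment μ F p x ≠ ∞ := by
  have h := hμ.moment_rpow_le hF hp ((one_lt_div hp).2 hpp) x y₀
  rw [mul_div_cancel₀ _ hp.ne'] at h
  have h2 := ne_top_of_le_ne_top (ENNReal.mul_ne_top hfin ENNReal.ofReal_ne_top) h
  intro h3
  rw [h3, ENNReal.top_rpow_of_pos (div_pos (hp.trans hpp) hp)] at h2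
  exact h2 rfl

/-- Standing assumptions on `F`: it does not vanish almost everywhere, and one of its moments of
order `p₀ > 1` is finite somewhere. -/
structure HasFiniteMoment (μ : X → Measure X) (F : X → ℝ≥0) (p₀ : ℝ) : Prop where
  measurable : Measurable F
  one_lt : 1 < p₀
  ne_zero : ∃ w, moment μ F 1 w ≠ 0
  ne_top : ∃ y, moment μ F p₀ y ≠ ∞

variable {p₀ : ℝ}

theorem HarnackFamily.toReal_moment_pos (hμ : HarnackFamily μ κ) (hF : HasFiniteMoment μ F p₀)
    {p : ℝ} (hp : 0 < p) (hpp : p < p₀) (x : X) : 0 < (moment μ F p x).toReal := by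
  obtain ⟨w, hw⟩ := hF.ne_zero
  obtain ⟨y, hy⟩ := hF.ne_top
  exact ENNReal.toReal_pos (hμ.moment_ne_zero hF.measurable hw p x)
    (hμ.moment_ne_top hF.measurable hy hp hpp x)

theorem HarnackFamily.ne_top (hμ : HarnackFamily μ κ) (hF : HasFiniteMoment μ F p₀)
    {p : ℝ} (hp : 0 < p) (hpp : p < p₀) (x : X) : moment μ F p x ≠ ∞ := by
  obtain ⟨y, hy⟩ := hF.ne_top
  exact hμ.moment_ne_top hF.measurable hy hp hpp x

theorem HarnackFamily.exp_logMoment (hμ : HarnackFamily μ κ) (hF : HasFiniteMoment μ F p₀)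
    {p : ℝ} (hp : 0 < p) (hpp : p < p₀) (x : X) :
    Real.exp (logMoment μ F p x) = (moment μ F p x).toReal :=
  Real.exp_log (hμ.toReal_moment_pos hF hp hpp x)

theorem HarnackFamily.logMoment_le (hμ : HarnackFamily μ κ) (hF : HasFiniteMoment μ F p₀)
    {p s : ℝ} (hp : 0 < p) (hs : 1 < s) (hps : p * s < p₀) (x y : X) :
    s * logMoment μ F p x ≤
      logMoment μ F (p * s) y + s * κ * dist x y ^ 2 / (4 * (s - 1)) := by
  have hps' : p < p₀ := lt_of_le_of_lt (le_mul_of_one_le_right hp.le hs.le) hps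
  have hps0 : 0 < p * s := mul_pos hp (one_pos.trans hs)
  have h := hμ.moment_rpow_le hF.measurable hp hs x y
  have h2 := ENNReal.toReal_mono (ENNReal.mul_ne_top (hμ.ne_top hF hps0 hps y)
    ENNReal.ofReal_ne_top) h
  rw [ENNReal.toReal_mul, ← ENNReal.toReal_rpow, ENNReal.toReal_ofReal (Real.exp_pos _).le] at h2
  have hx := hμ.toReal_moment_pos hF hp hps' x
  have hy := hμ.toReal_moment_pos hF hps0 hps y
  have h3 := Real.log_le_log (Real.rpow_pos_of_pos hx s) h2
  rwa [Real.log_rpow hx, Real.log_mul hy.ne' (Real.exp_pos _).ne', Real.log_exp] at h3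

/-- Hölder's inequality with exponents `1 / (1 - θ)` and `1 / θ`. -/
theorem HarnackFamily.logMoment_convex (hμ : HarnackFamily μ κ) (hF : HasFiniteMoment μ F p₀)
    {a b θ : ℝ} (ha : 0 < a) (ha' : a < p₀) (hb : 0 < b) (hb' : b < p₀) (hθ : 0 ≤ θ) (hθ' : θ ≤ 1)
    (x : X) : logMoment μ F ((1 - θ) * a + θ * b) x ≤
      (1 - θ) * logMoment μ F a x + θ * logMoment μ F b x := by
  have h1θ : 0 ≤ 1 - θ := by linarith
  have hA := hμ.toReal_moment_pos hF ha ha' x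
  have hB := hμ.toReal_moment_pos hF hb hb' x
  have hc : 0 < (1 - θ) * a + θ * b := by
    rcases hθ.eq_or_lt with h | h
    · rw [← h]; simpa using ha
    · exact add_pos_of_nonneg_of_pos (mul_nonneg h1θ ha.le) (mul_pos h hb)
  have hc' : (1 - θ) * a + θ * b < p₀ := by
    have : 0 < (1 - θ) * (p₀ - a) + θ * (p₀ - b) := by
      rcases hθ.eq_or_lt with h | h
      · rw [← h]; simpa using ha'
      · exact add_pos_of_nonneg_of_pos (mul_nonneg h1θ (by linarith)) (mul_pos h (by linarith))
    linarith
  have hC := hμ.toReal_moment_pos hF hc hc' x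
  have h := ENNReal.lintegral_mul_norm_pow_le (μ := μ x)
    (hF.measurable.coe_nnreal_ennreal.pow_const a).aemeasurable
    (hF.measurable.coe_nnreal_ennreal.pow_const b).aemeasurable h1θ hθ (by ring)
  have h1 : moment μ F ((1 - θ) * a + θ * b) x ≤
      moment μ F a x ^ (1 - θ) * moment μ F b x ^ θ := by
    refine le_trans (le_of_eq ?_) h
    refine lintegral_congr fun z => ?_
    rw [← ENNReal.rpow_mul, ← ENNReal.rpow_mul, ← ENNReal.rpow_add_of_nonneg _ _
      (mul_nonneg ha.le h1θ) (mul_nonneg hb.le hθ), mul_comm a, mul_comm b]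
  have h2 := ENNReal.toReal_mono (ENNReal.mul_ne_top
    (ENNReal.rpow_ne_top_of_nonneg h1θ (hμ.ne_top hF ha ha' x))
    (ENNReal.rpow_ne_top_of_nonneg hθ (hμ.ne_top hF hb hb' x))) h1
  rw [ENNReal.toReal_mul, ← ENNReal.toReal_rpow, ← ENNReal.toReal_rpow] at h2
  have h3 := Real.log_le_log hC h2
  rwa [Real.log_mul (Real.rpow_pos_of_pos hA _).ne' (Real.rpow_pos_of_pos hB _).ne',
    Real.log_rpow hA, Real.log_rpow hB] at h3

/-- The increment of `log ∫ F dμ` between two points, from the Harnack inequality with exponent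
`1 + α d(x, y)`. -/
theorem HarnackFamily.logMoment_sub_le (hμ : HarnackFamily μ κ) (hF : HasFiniteMoment μ F p₀)
    {α δ : ℝ} (hα : 0 < α) (hδ : 0 < δ) (hδp : 1 + δ < p₀) {x y : X} (hxy : x ≠ y)
    (hd : α * dist x y ≤ δ) :
    logMoment μ F 1 x - logMoment μ F 1 y ≤
      (α * ((logMoment μ F (1 + δ) y - logMoment μ F 1 y) / δ - logMoment μ F 1 x) +
        (1 + α * dist x y) * κ / (4 * α)) * dist x y := by
  have hd0 : 0 < dist x y := dist_pos.2 hxy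
  set d := dist x y
  have hαd : 0 < α * d := mul_pos hα hd0
  -- With `s - 1 = α d` the Gaussian term `s κ d² / (4 (s - 1))` becomes linear in `d`.
  have h1 := hμ.logMoment_le hF one_pos (s := 1 + α * d) (by linarith) (by linarith) x y
  -- The order `1 + α d` lies between `1` and `1 + δ`, with weight `θ = α d / δ`; this is where `α d
  -- ≤ δ` enters.
  have h2 := hμ.logMoment_convex hF one_pos (by linarith : (1 : ℝ) < p₀) (by linarith : 0 < 1 + δ)
    hδp (div_nonneg hαd.le hδ.le) ((div_le_one hδ).2 hd) y
  have e1 : (1 - α * d / δ) * 1 + α * d / δ * (1 + δ) = 1 * (1 + α * d) := by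
    field_simp; ring
  rw [e1] at h2
  have e2 : (1 + α * d) * κ * d ^ 2 / (4 * (1 + α * d - 1)) = (1 + α * d) * κ / (4 * α) * d := by
    field_simp; ring
  rw [e2] at h1
  have e3 : (1 - α * d / δ) * logMoment μ F 1 y + α * d / δ * logMoment μ F (1 + δ) y =
      logMoment μ F 1 y + α * d * ((logMoment μ F (1 + δ) y - logMoment μ F 1 y) / δ) := by
    field_simp; ring
  rw [e3] at h2
  change (1 + α * d) * logMoment μ F 1 x ≤ _ at h1
  linarith

theorem abs_exp_sub_exp_le {a b M : ℝ} (ha : a ≤ M) (hb : b ≤ M) :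
    |Real.exp a - Real.exp b| ≤ Real.exp M * |a - b| := by
  have key : ∀ a b : ℝ, a ≤ M → b ≤ a → |Real.exp a - Real.exp b| ≤ Real.exp M * |a - b| := by
    intro a b ha hab
    rw [abs_of_nonneg (sub_nonneg.2 (Real.exp_le_exp.2 hab)), abs_of_nonneg (sub_nonneg.2 hab)]
    have h1 : Real.exp b = Real.exp a * Real.exp (b - a) := by rw [← Real.exp_add]; ring_nf
    have h2 := Real.add_one_le_exp (b - a)
    have h3 := Real.exp_le_exp.2 ha
    have h4 := Real.exp_pos a
    calc Real.exp a - Real.exp b ≤ Real.exp a * (a - b) := by rw [h1]; nlinarith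
      _ ≤ _ := mul_le_mul_of_nonneg_right h3 (sub_nonneg.2 hab)
  rcases le_total b a with h | h
  · exact key a b ha h
  · rw [abs_sub_comm, abs_sub_comm a]; exact key b a hb h

theorem HarnackFamily.exists_lipschitzOnWith (hμ : HarnackFamily μ κ) (hF : HasFiniteMoment μ F p₀)
    {δ M : ℝ} (hδ : 0 < δ) (hδp : 1 + δ < p₀) {B : Set X}
    (h1 : ∀ x ∈ B, |logMoment μ F 1 x| ≤ M) (h2 : ∀ x ∈ B, |logMoment μ F (1 + δ) x| ≤ M) :
    ∃ C : ℝ≥0, LipschitzOnWith C (fun x => (moment μ F 1 x).toReal) B := by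
  rcases B.eq_empty_or_nonempty with rfl | ⟨b, hb⟩
  · exact ⟨0, by simp⟩
  have hM : 0 ≤ M := (abs_nonneg _).trans (h1 b hb)
  have hκ := hμ.pos
  -- The three terms bound those of `logMoment_sub_le` for `α = 1` and `d ≤ δ`: the difference
  -- quotient, `-logMoment μ F 1 x`, and the Gaussian term.
  set C₁ := 2 * M / δ + M + (1 + δ) * κ / 4 with hC₁
  have hC₁0 : 0 ≤ C₁ := by positivity
  have hlog : ∀ x ∈ B, ∀ y ∈ B, logMoment μ F 1 x - logMoment μ F 1 y ≤ C₁ * dist x y := by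
    intro x hx y hy
    have ax := abs_le.1 (h1 x hx)
    have ay := abs_le.1 (h1 y hy)
    have ay' := abs_le.1 (h2 y hy)
    rcases eq_or_ne x y with rfl | hxy
    · simp
    rcases le_total (dist x y) δ with hd | hd
    · refine (hμ.logMoment_sub_le hF one_pos hδ hδp hxy (by linarith)).trans ?_
      refine mul_le_mul_of_nonneg_right ?_ dist_nonneg
      have e1 : (logMoment μ F (1 + δ) y - logMoment μ F 1 y) / δ ≤ 2 * M / δ := by
        gcongr; linarith
      have e2 : (1 + 1 * dist x y) * κ / (4 * 1) ≤ (1 + δ) * κ / 4 := by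
        rw [one_mul, mul_one]; gcongr
      linarith
    -- At distance at least `δ` the trivial bound `2M` on the increment is already linear in the
    -- distance.
    · have e1 : 2 * M ≤ 2 * M / δ * dist x y := by
        rw [div_mul_eq_mul_div, le_div_iff₀ hδ]; gcongr
      have e2 : 0 ≤ (M + (1 + δ) * κ / 4) * dist x y := by positivity
      have e3 : C₁ * dist x y = 2 * M / δ * dist x y + (M + (1 + δ) * κ / 4) * dist x y := by
        rw [hC₁]; ring
      linarith
  refine ⟨Real.toNNReal (Real.exp M * C₁), LipschitzOnWith.of_dist_le_mul fun x hx y hy => ?_⟩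
  have hp := hF.one_lt
  rw [← hμ.exp_logMoment hF one_pos hp, ← hμ.exp_logMoment hF one_pos hp, Real.dist_eq]
  refine (abs_exp_sub_exp_le (abs_le.1 (h1 x hx)).2 (abs_le.1 (h1 y hy)).2).trans ?_
  rw [Real.coe_toNNReal _ (by positivity), mul_assoc]
  refine mul_le_mul_of_nonneg_left (abs_le.2 ⟨?_, hlog x hx y hy⟩) (Real.exp_pos _).le
  have := hlog y hy x hx
  rw [dist_comm] at this
  linarith

/-- Harnack is used in both directions against a base point `b`: the order `p * s` at `b` bounds
from above, the order `p / s` from below. The choice of `s` keeps `p * s` below `p₀`. -/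
theorem HarnackFamily.exists_abs_logMoment_le (hμ : HarnackFamily μ κ)
    (hF : HasFiniteMoment μ F p₀) {p : ℝ} (hp : 0 < p) (hpp : p < p₀) {B : Set X}
    (hB : Bornology.IsBounded B) : ∃ M, ∀ x ∈ B, |logMoment μ F p x| ≤ M := by
  rcases B.eq_empty_or_nonempty with rfl | ⟨b, hb⟩
  · exact ⟨0, by simp⟩
  obtain ⟨s, hs, hs'⟩ := exists_between ((one_lt_div hp).2 hpp)
  rw [lt_div_iff₀ hp, mul_comm] at hs'
  have hκ := hμ.pos
  set R := Metric.diam B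
  have hs0 : 0 < s := one_pos.trans hs
  have hs1 : 0 < s - 1 := sub_pos.2 hs
  have hdist : ∀ x y, x ∈ B → y ∈ B →
      s * κ * dist x y ^ 2 / (4 * (s - 1)) ≤ s * κ * R ^ 2 / (4 * (s - 1)) := fun x y hx hy => by
    have := Metric.dist_le_diam_of_mem hB hx hy
    gcongr
  refine ⟨max ((logMoment μ F (p * s) b + s * κ * R ^ 2 / (4 * (s - 1))) / s)
    (s * κ * R ^ 2 / (4 * (s - 1)) - s * logMoment μ F (p / s) b), fun x hx => ?_⟩
  have h1 := hμ.logMoment_le hF hp hs hs' x b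
  have h2 := hμ.logMoment_le hF (div_pos hp hs0) hs (by rwa [div_mul_cancel₀ _ hs0.ne']) b x
  rw [div_mul_cancel₀ _ hs0.ne'] at h2
  have h3 := hdist x b hx hb
  have h4 := hdist b x hb hx
  rw [abs_le]
  constructor
  · have := le_max_right ((logMoment μ F (p * s) b + s * κ * R ^ 2 / (4 * (s - 1))) / s)
      (s * κ * R ^ 2 / (4 * (s - 1)) - s * logMoment μ F (p / s) b)
    linarith
  · refine le_trans ?_ (le_max_left _ _)
    rw [le_div_iff₀ hs0]
    linarith

theorem HarnackFamily.isLipschitzOnBounded (hμ : HarnackFamily μ κ) (hF : HasFiniteMoment μ F p₀) :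
    IsLipschitzOnBounded (fun x => (moment μ F 1 x).toReal) := by
  intro B hB
  obtain ⟨q, hq, hq'⟩ := exists_between hF.one_lt
  have hq1 : 1 + (q - 1) = q := by ring
  obtain ⟨M₁, h1⟩ := hμ.exists_abs_logMoment_le hF one_pos hF.one_lt hB
  obtain ⟨M₂, h2⟩ := hμ.exists_abs_logMoment_le hF (one_pos.trans hq) hq' hB
  refine hμ.exists_lipschitzOnWith hF (sub_pos.2 hq) (by rwa [hq1]) (M := max M₁ M₂)
    (fun x hx => (h1 x hx).trans (le_max_left _ _)) fun x hx => ?_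
  rw [hq1]
  exact (h2 x hx).trans (le_max_right _ _)

theorem moment_rpow {q : ℝ} (hq : 0 ≤ q) (p : ℝ) (x : X) :
    moment μ (fun z => F z ^ q) p x = moment μ F (q * p) x := by
  simp only [moment, ENNReal.coe_rpow_of_nonneg _ hq, ← ENNReal.rpow_mul]

/-- Moments of order `q` are first moments of `F ^ q`, so regularity proved for first moments
extends to every order below `p₀`. -/
theorem HarnackFamily.hasFiniteMoment_rpow (hμ : HarnackFamily μ κ) (hF : HasFiniteMoment μ F p₀)
    {q : ℝ} (hq : 0 < q) (hqp : q < p₀) : HasFiniteMoment μ (fun z => F z ^ q) (p₀ / q) where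
  measurable := hF.measurable.pow_const q
  one_lt := (one_lt_div hq).2 hqp
  ne_zero := by
    obtain ⟨w, hw⟩ := hF.ne_zero
    refine ⟨w, ?_⟩
    rw [moment_rpow hq.le, mul_one]
    exact hμ.moment_ne_zero hF.measurable hw q w
  ne_top := by
    obtain ⟨y, hy⟩ := hF.ne_top
    refine ⟨y, ?_⟩
    rwa [moment_rpow hq.le, mul_div_cancel₀ _ hq.ne']

theorem HarnackFamily.continuous_logMoment (hμ : HarnackFamily μ κ) (hF : HasFiniteMoment μ F p₀)
    {q : ℝ} (hq : 0 < q) (hqp : q < p₀) : Continuous (logMoment μ F q) := by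
  have h := (hμ.isLipschitzOnBounded (hμ.hasFiniteMoment_rpow hF hq hqp)).continuous
  simp only [moment_rpow hq.le, mul_one] at h
  exact h.log fun x => (hμ.toReal_moment_pos hF hq hqp x).ne'

end Harnack

/-! ### Differentiating powers in the exponent -/

section Derivative

theorem abs_mul_log_le {a η : ℝ} (ha : 0 ≤ a) (hη : 0 < η) :
    |a * Real.log a| ≤ a ^ (1 + η) / η + 1 := by
  rcases ha.eq_or_lt with rfl | ha'
  · simp only [zero_mul, abs_zero]; positivity
  rcases le_total a 1 with h | h
  · have h1 := Real.abs_log_mul_self_lt a ha' h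
    rw [mul_comm] at h1
    have : 0 ≤ a ^ (1 + η) / η := by positivity
    linarith
  · have h1 := Real.log_le_rpow_div ha hη
    have h2 := Real.log_nonneg h
    rw [abs_of_nonneg (by positivity), Real.rpow_add ha', Real.rpow_one]
    have := mul_le_mul_of_nonneg_left h1 ha
    rw [← mul_div_assoc] at this
    linarith

/-- The bound does not depend on `δ`, as dominated convergence requires. For `a ≤ 1` the quotient is
controlled by `|a log a| < 1`; for `a ≥ 1`, by `(a^δ - 1) / δ ≤ a^δ log a ≤ a^η · a^η / η`. -/
theorem abs_rpow_sub_div_le {a δ η : ℝ} (ha : 0 ≤ a) (hδ : 0 < δ) (hδη : δ ≤ η) :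
    |(a ^ (1 + δ) - a) / δ| ≤ a ^ (1 + 2 * η) / η + 1 := by
  have hη : 0 < η := hδ.trans_le hδη
  rcases ha.eq_or_lt with rfl | ha'
  · rw [Real.zero_rpow (by linarith)]; simp only [sub_zero, zero_div, abs_zero]; positivity
  have hpos : 0 < a ^ δ := Real.rpow_pos_of_pos ha' _
  have hlog : Real.log (a ^ δ) = δ * Real.log a := Real.log_rpow ha' δ
  have e1 : (a ^ (1 + δ) - a) / δ = a * ((a ^ δ - 1) / δ) := by
    rw [Real.rpow_add ha', Real.rpow_one]; ring
  rw [e1, abs_mul, abs_of_pos ha']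
  have hup : δ * Real.log a ≤ a ^ δ - 1 := hlog ▸ Real.log_le_sub_one_of_pos hpos
  rcases le_total a 1 with h | h
  · have h1 := Real.abs_log_mul_self_lt a ha' h
    have hl : Real.log a ≤ 0 := Real.log_nonpos ha h
    have h2 : a ^ δ ≤ 1 := Real.rpow_le_one ha h hδ.le
    rw [abs_of_nonpos (div_nonpos_of_nonpos_of_nonneg (by linarith) hδ.le)]
    rw [abs_mul, abs_of_nonpos hl, abs_of_pos ha'] at h1
    have h3 : -((a ^ δ - 1) / δ) ≤ -Real.log a := by
      rw [neg_le_neg_iff, le_div_iff₀ hδ]; linarith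
    have h4 := mul_le_mul_of_nonneg_left h3 ha
    have : 0 ≤ a ^ (1 + 2 * η) / η := by positivity
    linarith
  · have h2 : 1 ≤ a ^ δ := Real.one_le_rpow h hδ.le
    rw [abs_of_nonneg (div_nonneg (by linarith) hδ.le)]
    have h3 : 1 - (a ^ δ)⁻¹ ≤ δ * Real.log a := hlog ▸ Real.one_sub_inv_le_log_of_pos hpos
    have h4 : (a ^ δ - 1) / δ ≤ a ^ δ * Real.log a := by
      rw [div_le_iff₀ hδ]
      have := mul_le_mul_of_nonneg_left h3 hpos.le
      rw [mul_sub, mul_inv_cancel₀ hpos.ne', mul_one] at this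
      linarith
    have h5 := Real.log_le_rpow_div ha hη
    have h6 : a ^ δ ≤ a ^ η := Real.rpow_le_rpow_of_exponent_le h hδη
    have h7 : a ^ δ * Real.log a ≤ a ^ η * (a ^ η / η) :=
      mul_le_mul h6 h5 (Real.log_nonneg h) (by positivity)
    have h8 : a ^ (1 + 2 * η) = a * (a ^ η * a ^ η) := by
      rw [two_mul, Real.rpow_add ha', Real.rpow_add ha', Real.rpow_one]
    rw [h8]
    have h9 := mul_le_mul_of_nonneg_left (h4.trans h7) ha
    calc a * ((a ^ δ - 1) / δ) ≤ a * (a ^ η * (a ^ η / η)) := h9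
      _ = a * (a ^ η * a ^ η) / η := by ring
      _ ≤ _ := by linarith

theorem tendsto_rpow_sub_div {a : ℝ} (ha : 0 ≤ a) :
    Tendsto (fun δ : ℝ => (a ^ (1 + δ) - a) / δ) (𝓝[>] 0) (𝓝 (a * Real.log a)) := by
  rcases ha.eq_or_lt with rfl | ha'
  · simp only [zero_mul]
    refine tendsto_const_nhds.congr' ?_
    filter_upwards [self_mem_nhdsWithin] with δ hδ
    have hδ' : (0 : ℝ) < δ := hδ
    rw [Real.zero_rpow (by linarith)]; simp
  · have h : HasDerivAt (fun δ : ℝ => a ^ (1 + δ)) (a * Real.log a) 0 := by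
      have h1 : HasDerivAt (fun δ : ℝ => 1 + δ) 1 0 := (hasDerivAt_id 0).const_add 1
      have h2 := h1.const_rpow ha'
      simpa [mul_comm] using h2
    have h3 := h.tendsto_slope.mono_left (nhdsWithin_mono 0 (fun x (hx : 0 < x) => hx.ne'))
    refine h3.congr fun δ => ?_
    simp [slope_def_field]

end Derivative

/-! ### Entropy and the local logarithmic Sobolev estimate -/

section Entropy

variable {X : Type*} [MetricSpace X] [MeasurableSpace X] {μ : X → Measure X} {κ : ℝ} {F : X → ℝ≥0}
  {p₀ : ℝ}

theorem HarnackFamily.integrable_rpow (hμ : HarnackFamily μ κ) (hF : HasFiniteMoment μ F p₀)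
    {p : ℝ} (hp : 0 < p) (hpp : p < p₀) (x : X) : Integrable (fun z => (F z : ℝ) ^ p) (μ x) := by
  refine ⟨((hF.measurable.coe_nnreal_real).pow_const p).aestronglyMeasurable, ?_⟩
  refine lt_of_le_of_lt (le_of_eq ?_) (hμ.ne_top hF hp hpp x).lt_top
  refine lintegral_congr fun z => ?_
  simp only
  rw [← NNReal.coe_rpow, NNReal.enorm_eq, ENNReal.coe_rpow_of_nonneg _ hp.le]

theorem HarnackFamily.toReal_moment (hμ : HarnackFamily μ κ) (hF : HasFiniteMoment μ F p₀)
    {p : ℝ} (hp : 0 < p) (hpp : p < p₀) (x : X) :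
    (moment μ F p x).toReal = ∫ z, (F z : ℝ) ^ p ∂μ x := by
  rw [integral_eq_lintegral_of_nonneg_ae (Eventually.of_forall fun z => by positivity)
    (hμ.integrable_rpow hF hp hpp x).1]
  congr 1
  refine lintegral_congr fun z => ?_
  rw [← NNReal.coe_rpow, ENNReal.ofReal_coe_nnreal, ENNReal.coe_rpow_of_nonneg _ hp.le]

theorem HarnackFamily.toReal_moment_one (hμ : HarnackFamily μ κ) (hF : HasFiniteMoment μ F p₀)
    (x : X) : (moment μ F 1 x).toReal = ∫ z, (F z : ℝ) ∂μ x := by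
  rw [hμ.toReal_moment hF one_pos hF.one_lt]
  simp

theorem HarnackFamily.integrable_mul_log (hμ : HarnackFamily μ κ) (hF : HasFiniteMoment μ F p₀)
    (x : X) : Integrable (fun z => (F z : ℝ) * Real.log (F z)) (μ x) := by
  obtain ⟨q, hq, hq'⟩ := exists_between hF.one_lt
  have := hμ.prob x
  have hm := hF.measurable.coe_nnreal_real
  refine Integrable.mono' (((hμ.integrable_rpow hF (one_pos.trans hq) hq' x).div_const (q - 1)).add
    (integrable_const 1)) (hm.mul hm.log).aestronglyMeasurable (Eventually.of_forall fun z => ?_)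
  have h := abs_mul_log_le (F z).2 (sub_pos.2 hq)
  rw [add_sub_cancel] at h
  exact h

theorem HarnackFamily.tendsto_moment_slope (hμ : HarnackFamily μ κ) (hF : HasFiniteMoment μ F p₀)
    (x : X) : Tendsto (fun δ : ℝ => ∫ z, ((F z : ℝ) ^ (1 + δ) - F z) / δ ∂μ x) (𝓝[>] 0)
      (𝓝 (∫ z, (F z : ℝ) * Real.log (F z) ∂μ x)) := by
  obtain ⟨q, hq, hq'⟩ := exists_between hF.one_lt
  have := hμ.prob x
  have hm := hF.measurable.coe_nnreal_real
  -- With `η = (q - 1) / 2` the dominating power `1 + 2η` is `q`, an order whose moment is finite.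
  have hη : 0 < (q - 1) / 2 := by linarith
  refine tendsto_integral_filter_of_dominated_convergence
    (fun z => (F z : ℝ) ^ q / ((q - 1) / 2) + 1) ?_ ?_ ?_ ?_
  · exact Eventually.of_forall fun δ =>
      (((hm.pow_const (1 + δ)).sub hm).div_const δ).aestronglyMeasurable
  · filter_upwards [Ioc_mem_nhdsGT hη] with δ hδ
    refine Eventually.of_forall fun z => ?_
    have h := abs_rpow_sub_div_le (F z).2 hδ.1 hδ.2
    have e : 1 + 2 * ((q - 1) / 2) = q := by ring
    rw [e] at h
    exact h
  · exact ((hμ.integrable_rpow hF (one_pos.trans hq) hq' x).div_const _).add (integrable_const 1)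
  · exact Eventually.of_forall fun z => tendsto_rpow_sub_div (F z).2

/-- The derivative of the log-moment at order `1` is `∫ F log F / ∫ F`. Only an upper bound on
slopes is needed, and `log b - log a ≤ b / a - 1` reduces it to the slopes of the moments
themselves. -/
theorem HarnackFamily.exists_slope_lt (hμ : HarnackFamily μ κ) (hF : HasFiniteMoment μ F p₀)
    (x : X) {c : ℝ}
    (hc : (∫ z, (F z : ℝ) * Real.log (F z) ∂μ x) / (moment μ F 1 x).toReal < c) :
    ∃ δ, 0 < δ ∧ 1 + δ < p₀ ∧ (logMoment μ F (1 + δ) x - logMoment μ F 1 x) / δ < c := by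
  have hpos := hμ.toReal_moment_pos hF one_pos hF.one_lt x
  have h1 := (hμ.tendsto_moment_slope hF x).div_const (moment μ F 1 x).toReal
  have h2 : Ioo (0 : ℝ) (p₀ - 1) ∈ 𝓝[>] (0 : ℝ) := Ioo_mem_nhdsGT (sub_pos.2 hF.one_lt)
  obtain ⟨δ, hδc, hδ⟩ := ((h1.eventually_lt_const hc).and h2).exists
  have hp1 : 0 < 1 + δ := by linarith [hδ.1]
  have hp2 : 1 + δ < p₀ := by linarith [hδ.2]
  refine ⟨δ, hδ.1, hp2, lt_of_le_of_lt ?_ hδc⟩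
  have hpos' := hμ.toReal_moment_pos hF hp1 hp2 x
  have hlog : logMoment μ F (1 + δ) x - logMoment μ F 1 x ≤
      (moment μ F (1 + δ) x).toReal / (moment μ F 1 x).toReal - 1 := by
    rw [logMoment, logMoment, ← Real.log_div hpos'.ne' hpos.ne']
    exact Real.log_le_sub_one_of_pos (div_pos hpos' hpos)
  have hi1 := hμ.integrable_rpow hF hp1 hp2 x
  have hi2 : Integrable (fun z => (F z : ℝ)) (μ x) := by
    simpa using hμ.integrable_rpow hF one_pos hF.one_lt x
  rw [integral_div, integral_sub hi1 hi2, ← hμ.toReal_moment hF hp1 hp2,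
    ← hμ.toReal_moment_one hF]
  calc _ ≤ ((moment μ F (1 + δ) x).toReal / (moment μ F 1 x).toReal - 1) / δ := by
        have := hδ.1; gcongr
    _ = _ := by have := hδ.1; field_simp

/-- Jensen's inequality for the convex function `x log x`. -/
theorem HarnackFamily.entropy_nonneg (hμ : HarnackFamily μ κ) (hF : HasFiniteMoment μ F p₀)
    (x : X) : (moment μ F 1 x).toReal * logMoment μ F 1 x ≤
      ∫ z, (F z : ℝ) * Real.log (F z) ∂μ x := by
  have := hμ.prob x
  rw [logMoment, hμ.toReal_moment_one hF]
  exact Real.convexOn_mul_log.map_integral_le Real.continuous_mul_log.continuousOn isClosed_Ici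
    (Eventually.of_forall fun z => (F z).2)
    (by simpa using hμ.integrable_rpow hF one_pos hF.one_lt x) (hμ.integrable_mul_log hF x)

/-- Fix `δ` with a slope at `x` close to the derivative. The increment estimate then has
coefficients that are continuous in the moving point, in both directions, so a strict bound at `x`
persists nearby. -/
theorem HarnackFamily.eventually_abs_logMoment_sub_le (hμ : HarnackFamily μ κ)
    (hF : HasFiniteMoment μ F p₀) (x : X) {α β : ℝ} (hα : 0 < α)
    (hβ : α * ((∫ z, (F z : ℝ) * Real.log (F z) ∂μ x) / (moment μ F 1 x).toReal -
      logMoment μ F 1 x) + κ / (4 * α) < β) :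
    ∀ᶠ y in 𝓝 x, |logMoment μ F 1 y - logMoment μ F 1 x| ≤ β * dist y x := by
  set D := (∫ z, (F z : ℝ) * Real.log (F z) ∂μ x) / (moment μ F 1 x).toReal
  set ℓ := logMoment μ F 1 x
  obtain ⟨c, hDc, hcβ⟩ : ∃ c, D < c ∧ α * (c - ℓ) + κ / (4 * α) < β := by
    -- Half of the gap below `β`, divided by `α`.
    refine ⟨D + (β - (α * (D - ℓ) + κ / (4 * α))) / (2 * α), ?_, ?_⟩
    · have : 0 < (β - (α * (D - ℓ) + κ / (4 * α))) / (2 * α) :=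
        div_pos (sub_pos.2 hβ) (by linarith)
      linarith
    · have e : α * (D + (β - (α * (D - ℓ) + κ / (4 * α))) / (2 * α) - ℓ) =
          α * (D - ℓ) + (β - (α * (D - ℓ) + κ / (4 * α))) / 2 := by
        field_simp
        ring
      rw [e]; linarith
  obtain ⟨δ, hδ, hδp, hslope⟩ := hμ.exists_slope_lt hF x hDc
  have c0 := hμ.continuous_logMoment hF one_pos hF.one_lt
  have c1 := hμ.continuous_logMoment hF (by linarith : 0 < 1 + δ) hδp
  -- The coefficient of the distance in `logMoment_sub_le` for the pair `(a, b)`.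
  let Q : X → X → ℝ := fun a b =>
    α * ((logMoment μ F (1 + δ) b - logMoment μ F 1 b) / δ - logMoment μ F 1 a) +
      (1 + α * dist a b) * κ / (4 * α)
  have hQx : Q x x < β := by
    refine lt_of_le_of_lt ?_ hcβ
    simp only [Q, dist_self, mul_zero, add_zero, one_mul]
    gcongr
  have hQ1 : Continuous (fun y => Q y x) := by
    simp only [Q]; fun_prop
  have hQ2 : Continuous (fun y => Q x y) := by
    simp only [Q]; fun_prop
  have hd : ∀ᶠ y in 𝓝 x, α * dist y x < δ := by
    have hcont : Continuous (fun y => α * dist y x) := by fun_prop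
    exact (hcont.tendsto x).eventually_lt_const (by simpa using hδ)
  filter_upwards [(hQ1.tendsto x).eventually_lt_const hQx,
    (hQ2.tendsto x).eventually_lt_const hQx, hd] with y h1 h2 h3
  rcases eq_or_ne y x with rfl | hyx
  · simp [ℓ]
  have hdist : 0 ≤ dist y x := dist_nonneg
  have a1 := hμ.logMoment_sub_le hF hα hδ hδp hyx h3.le
  have a2 := hμ.logMoment_sub_le hF hα hδ hδp hyx.symm (by rw [dist_comm]; exact h3.le)
  have b1 : Q y x * dist y x ≤ β * dist y x := mul_le_mul_of_nonneg_right h1.le hdist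
  have b2 : Q x y * dist x y ≤ β * dist y x := by
    rw [dist_comm x y]; exact mul_le_mul_of_nonneg_right h2.le hdist
  rw [abs_le]
  constructor
  · have := a2.trans b2
    simp only [ℓ]
    linarith
  · exact a1.trans b1

theorem HarnackFamily.lip_moment_le (hμ : HarnackFamily μ κ) (hF : HasFiniteMoment μ F p₀) (x : X)
    {β : ℝ}
    (hβ : ∀ᶠ y in 𝓝 x, |logMoment μ F 1 y - logMoment μ F 1 x| ≤ β * dist y x) :
    lip (fun y => (moment μ F 1 y).toReal) x ≤
      ENNReal.ofReal (β * (moment μ F 1 x).toReal) := by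
  have c0 := hμ.continuous_logMoment hF one_pos hF.one_lt
  set ℓ := logMoment μ F 1 x with hℓ
  rw [← hμ.exp_logMoment hF one_pos hF.one_lt]
  -- Near `x` the log-moment stays below any `M > ℓ`, where `exp` has Lipschitz constant `exp M`;
  -- then `M ↓ ℓ`.
  have hlim : Tendsto (fun M => ENNReal.ofReal (β * Real.exp M)) (𝓝[>] ℓ)
      (𝓝 (ENNReal.ofReal (β * Real.exp ℓ))) := by
    have : Continuous (fun M => ENNReal.ofReal (β * Real.exp M)) :=
      ENNReal.continuous_ofReal.comp (by fun_prop)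
    exact (this.tendsto ℓ).mono_left nhdsWithin_le_nhds
  refine ge_of_tendsto hlim ?_
  filter_upwards [self_mem_nhdsWithin] with M hM
  refine lip_le_of_eventually (Eventually.filter_mono nhdsWithin_le_nhds ?_)
  filter_upwards [hβ, (c0.tendsto x).eventually_lt_const hM] with y h1 h2
  rw [edist_dist, edist_dist, ← ENNReal.ofReal_mul' dist_nonneg]
  refine ENNReal.ofReal_le_ofReal ?_
  rw [← hμ.exp_logMoment hF one_pos hF.one_lt, ← hμ.exp_logMoment hF one_pos hF.one_lt,
    Real.dist_eq]
  refine (abs_exp_sub_exp_le h2.le (le_of_lt hM)).trans ?_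
  have := mul_le_mul_of_nonneg_left h1 (Real.exp_pos M).le
  linarith

/-- The minimum of `α A + κ / (4 α)` is `√(κ A)`, attained at `α = √(κ A) / (2 A)`. For `A = 0` the
infimum `0` is only approached, as `α → ∞`. -/
theorem le_ofReal_sqrt_of_forall {L : ℝ≥0∞} {A κ c : ℝ} (hA : 0 ≤ A) (hκ : 0 < κ) (hc : 0 ≤ c)
    (h : ∀ α > 0, L ≤ ENNReal.ofReal ((α * A + κ / (4 * α)) * c)) :
    L ^ 2 ≤ ENNReal.ofReal (κ * A * c ^ 2) := by
  rcases hA.eq_or_lt with rfl | hA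
  · have hlim : Tendsto (fun α : ℝ => ENNReal.ofReal ((α * 0 + κ / (4 * α)) * c)) atTop
        (𝓝 (ENNReal.ofReal (0 * c))) := by
      refine (ENNReal.continuous_ofReal.tendsto _).comp (Tendsto.mul_const c ?_)
      simp only [mul_zero, zero_add]
      exact tendsto_const_nhds.div_atTop (tendsto_id.const_mul_atTop (by norm_num))
    have h0 := ge_of_tendsto hlim ((eventually_gt_atTop 0).mono h)
    simp only [zero_mul, ENNReal.ofReal_zero, nonpos_iff_eq_zero] at h0
    simp [h0]
  · have hs := Real.sqrt_pos.2 (mul_pos hκ hA)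
    have hs2 := Real.mul_self_sqrt (mul_pos hκ hA).le
    set s := Real.sqrt (κ * A)
    have h1 := h (s / (2 * A)) (by positivity)
    have e : s / (2 * A) * A + κ / (4 * (s / (2 * A))) = s := by
      field_simp
      nlinarith
    rw [e] at h1
    refine (pow_le_pow_left' h1 2).trans (le_of_eq ?_)
    rw [← ENNReal.ofReal_pow (by positivity), mul_pow, sq s, hs2]

/-- The local logarithmic Sobolev estimate for a family of measures satisfying the dimension-free
Harnack inequality. -/
theorem HarnackFamily.lip_sq_le (hμ : HarnackFamily μ κ) (hF : HasFiniteMoment μ F p₀) (x : X) :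
    lip (fun y => (moment μ F 1 y).toReal) x ^ 2 ≤
      ENNReal.ofReal (κ * (moment μ F 1 x).toReal *
        ((∫ z, (F z : ℝ) * Real.log (F z) ∂μ x) -
          (moment μ F 1 x).toReal * Real.log (moment μ F 1 x).toReal)) := by
  have hpos := hμ.toReal_moment_pos hF one_pos hF.one_lt x
  have hent := hμ.entropy_nonneg hF x
  set c := (moment μ F 1 x).toReal with hc
  set e := ∫ z, (F z : ℝ) * Real.log (F z) ∂μ x
  have hA : 0 ≤ e / c - logMoment μ F 1 x := by
    rw [sub_nonneg, le_div_iff₀ hpos, mul_comm]; exact hent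
  refine (le_ofReal_sqrt_of_forall (A := e / c - logMoment μ F 1 x) (c := c) hA hμ.pos hpos.le
    fun α hα => ?_).trans (le_of_eq ?_)
  · have hlim : Tendsto (fun β => ENNReal.ofReal (β * c))
        (𝓝[>] (α * (e / c - logMoment μ F 1 x) + κ / (4 * α)))
        (𝓝 (ENNReal.ofReal ((α * (e / c - logMoment μ F 1 x) + κ / (4 * α)) * c))) := by
      have : Continuous (fun β => ENNReal.ofReal (β * c)) :=
        ENNReal.continuous_ofReal.comp (by fun_prop)
      exact (this.tendsto _).mono_left nhdsWithin_le_nhds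
    refine ge_of_tendsto hlim ?_
    filter_upwards [self_mem_nhdsWithin] with β hβ
    exact hμ.lip_moment_le hF x (hμ.eventually_abs_logMoment_sub_le hF x hα hβ)
  · congr 1
    rw [logMoment, ← hc]
    field_simp

end Entropy

/-! ### Application to the heat kernel -/

section Kernel

theorem rate_pos (K : ℝ) {t : ℝ} (ht : 0 < t) : 0 < rate K t := by
  rw [rate]
  split_ifs with h
  · positivity
  · rcases lt_or_gt_of_ne h with h | h
    · refine div_pos_of_neg_of_neg (by linarith) ?_
      rw [sub_neg, Real.exp_lt_one_iff]
      nlinarith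
    · refine div_pos (by linarith) ?_
      rw [sub_pos, Real.one_lt_exp_iff]
      positivity

variable {X : Type*} [MetricSpace X] [MeasurableSpace X] [BorelSpace X]
  {m : Measure X} {r : ℝ → X → X → ℝ} {K t : ℝ}

/-- The assumption covers `L¹ ∩ L^∞` only. A general `F` is cut off in value and to balls, which
have finite measure; on the left the cut-offs converge monotonically, on the right they are simply
bounded by `F`. -/
theorem IsHeatKernel.harnackFamily (hr : IsHeatKernel m r) (hH : DimFreeHarnack m r K)
    (hm : ∀ s : Set X, Bornology.IsBounded s → m s < ∞) (ht : 0 < t) :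
    HarnackFamily (kernelMeasure m r t) (rate K t) where
  prob := hr.isProbabilityMeasure ht
  ac x y := (kernelMeasure_absolutelyContinuous t x).trans (hr.absolutelyContinuous ht y)
  pos := rate_pos K ht
  harnack p hp F hF x y := by
    have hp0 : 0 < p := one_pos.trans hp
    let G : ℕ → X → ℝ≥0 := fun n => (Metric.ball x n).indicator fun z => min (F z) n
    have hGm : ∀ n, Measurable (G n) := fun n =>
      (hF.min measurable_const).indicator Metric.isOpen_ball.measurableSet
    have hGF : ∀ n z, G n z ≤ F z := fun n z =>
      (indicator_le_self' (fun _ _ => zero_le) z).trans (min_le_left _ _)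
    have hGn : ∀ n z, G n z ≤ n := fun n z =>
      (indicator_le_self' (fun _ _ => zero_le) z).trans (min_le_right _ _)
    have hGt : ∀ n, ∀ ν : Measure X, MemLp (fun z => (G n z : ℝ)) ∞ ν := fun n ν =>
      memLp_top_of_bound (hGm n).coe_nnreal_real.aestronglyMeasurable n
        (Eventually.of_forall fun z => by
          rw [NNReal.norm_eq]; exact_mod_cast hGn n z)
    have hG1 : ∀ n, MemLp (fun z => (G n z : ℝ)) 1 m := fun n => by
      refine memLp_one_iff_integrable.2
        ⟨(hGm n).coe_nnreal_real.aestronglyMeasurable, ?_⟩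
      refine lt_of_le_of_lt (b := ∫⁻ z, (Metric.ball x n).indicator (fun _ => (n : ℝ≥0∞)) z ∂m)
        (lintegral_mono fun z => ?_) ?_
      · simp only [NNReal.enorm_eq, G, indicator]
        split_ifs
        · exact_mod_cast min_le_right _ _
        · simp
      · rw [lintegral_indicator Metric.isOpen_ball.measurableSet, setLIntegral_const]
        exact ENNReal.mul_lt_top (ENNReal.natCast_lt_top n) (hm _ Metric.isBounded_ball)
    have hint : ∀ n w, ∫⁻ z, G n z ∂kernelMeasure m r t w
        = ENNReal.ofReal (kernelFlow m r t (fun z => (G n z : ℝ)) w) := fun n w => by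
      have := hr.isProbabilityMeasure ht w
      rw [← hr.integral_kernelMeasure ht, ofReal_integral_eq_lintegral_ofReal
        ((hGt n _).integrable le_top) (Eventually.of_forall fun z => NNReal.coe_nonneg _)]
      simp
    have hintp : ∀ n w, ENNReal.ofReal (kernelFlow m r t (fun z => |(G n z : ℝ)| ^ p) w)
        ≤ ∫⁻ z, (F z : ℝ≥0∞) ^ p ∂kernelMeasure m r t w := fun n w => by
      rw [← hr.integral_kernelMeasure ht]
      have := hr.isProbabilityMeasure ht w
      have hi : Integrable (fun z => |(G n z : ℝ)| ^ p) (kernelMeasure m r t w) := by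
        refine (memLp_top_of_bound (C := (n : ℝ) ^ p)
          ((hGm n).coe_nnreal_real.abs.pow_const p).aestronglyMeasurable
          (Eventually.of_forall fun z => ?_)).integrable le_top
        rw [Real.norm_of_nonneg (by positivity), abs_of_nonneg (NNReal.coe_nonneg _)]
        exact Real.rpow_le_rpow (NNReal.coe_nonneg _) (by exact_mod_cast hGn n z) hp0.le
      rw [ofReal_integral_eq_lintegral_ofReal hi (Eventually.of_forall fun z => by positivity)]
      refine lintegral_mono fun z => ?_
      rw [abs_of_nonneg (NNReal.coe_nonneg _), ← ENNReal.ofReal_rpow_of_nonneg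
        (NNReal.coe_nonneg _) hp0.le, ENNReal.ofReal_coe_nnreal]
      gcongr
      exact_mod_cast hGF n z
    have hsup : ∫⁻ z, F z ∂kernelMeasure m r t x = ⨆ n, ∫⁻ z, G n z ∂kernelMeasure m r t x := by
      rw [← lintegral_iSup (fun n => (hGm n).coe_nnreal_ennreal)]
      · refine lintegral_congr fun z => ?_
        refine le_antisymm ?_ (iSup_le fun n => by exact_mod_cast hGF n z)
        obtain ⟨n₁, h₁⟩ := exists_nat_ge (F z)
        obtain ⟨n₂, h₂⟩ := exists_nat_gt (dist z x)
        refine le_iSup_of_le (max n₁ n₂) ?_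
        have hz : z ∈ Metric.ball x ((max n₁ n₂ : ℕ) : ℝ) := by
          rw [Metric.mem_ball]
          exact h₂.trans_le (by exact_mod_cast le_max_right _ _)
        have hle : F z ≤ ((max n₁ n₂ : ℕ) : ℝ≥0) :=
          h₁.trans (by exact_mod_cast le_max_left _ _)
        simp only [G, indicator_of_mem hz, min_eq_left hle]
        exact le_rfl
      · intro a b hab z
        have hab' : (a : ℝ≥0) ≤ b := by exact_mod_cast hab
        have hsub : Metric.ball x (a : ℝ) ⊆ Metric.ball x b :=
          Metric.ball_subset_ball (by exact_mod_cast hab)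
        simp only [G]
        refine ENNReal.coe_le_coe.2 ?_
        refine (indicator_le_indicator_of_subset hsub (fun _ => zero_le) z).trans ?_
        exact indicator_le_indicator (min_le_min_left _ hab')
    -- Taking the `p`-th root frees the supremum from the power.
    rw [← ENNReal.le_rpow_inv_iff hp0, hsup]
    refine iSup_le fun n => ?_
    rw [ENNReal.le_rpow_inv_iff hp0, hint]
    have h := hH p hp t ht _ (hG1 n) (hGt n m) x y
    have h0 : 0 ≤ kernelFlow m r t (fun z => (G n z : ℝ)) x := by
      rw [← hr.integral_kernelMeasure ht]
      exact integral_nonneg fun z => NNReal.coe_nonneg _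
    rw [abs_of_nonneg h0] at h
    rw [ENNReal.ofReal_rpow_of_nonneg h0 hp0.le]
    refine (ENNReal.ofReal_le_ofReal h).trans ?_
    rw [ENNReal.ofReal_mul' (Real.exp_pos _).le]
    gcongr
    exact hintp n y

theorem ae_kernelMeasure_of_ae {P : X → Prop} (h : ∀ᵐ z ∂m, P z) (t : ℝ) (x : X) :
    ∀ᵐ z ∂kernelMeasure m r t x, P z :=
  (kernelMeasure_absolutelyContinuous t x).ae_le h

theorem kernelFlow_congr {f g : X → ℝ} (h : f =ᵐ[m] g) (x : X) :
    kernelFlow m r t f x = kernelFlow m r t g x :=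
  integral_congr_ae (h.mono fun y hy => by simp only [hy])

/-- Regularity of the heat flow of a nonnegative function with a finite moment, and the local
logarithmic Sobolev inequality. -/
theorem IsHeatKernel.regularity (hr : IsHeatKernel m r) (hH : DimFreeHarnack m r K)
    (hm : ∀ s : Set X, Bornology.IsBounded s → m s < ∞) (ht : 0 < t) {f : X → ℝ} {F : X → ℝ≥0}
    (hF : Measurable F) (hfF : f =ᵐ[m] fun z => (F z : ℝ)) {p : ℝ} (hp : 1 < p)
    (hfin : ∃ y, moment (kernelMeasure m r t) F p y ≠ ∞) :
    IsLipschitzOnBounded (kernelFlow m r t f) ∧ ∀ x,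
      Integrable (fun y => f y * r t x y) m ∧
      Integrable (fun y => f y * Real.log (f y) * r t x y) m ∧
      ((lip (kernelFlow m r t f) x ^ 2 : ℝ≥0∞) : EReal) ≤ (logSobolevBound m r K t f x : ℝ) := by
  have hμ := hr.harnackFamily hH hm ht
  have hlogF : (fun z => f z * Real.log (f z)) =ᵐ[m] fun z => (F z : ℝ) * Real.log (F z) :=
    hfF.mono fun z hz => by simp only [hz]
  have hint : ∀ x, kernelFlow m r t f x = ∫ z, (F z : ℝ) ∂kernelMeasure m r t x := fun x => by
    rw [kernelFlow_congr hfF, hr.integral_kernelMeasure ht]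
  have hint' : ∀ x, kernelFlow m r t (fun z => f z * Real.log (f z)) x
      = ∫ z, (F z : ℝ) * Real.log (F z) ∂kernelMeasure m r t x := fun x => by
    rw [kernelFlow_congr hlogF, hr.integral_kernelMeasure ht]
  by_cases hne : ∃ w, moment (kernelMeasure m r t) F 1 w ≠ 0
  · have hFm : HasFiniteMoment (kernelMeasure m r t) F p := ⟨hF, hp, hne, hfin⟩
    have hflow : kernelFlow m r t f = fun x => (moment (kernelMeasure m r t) F 1 x).toReal := by
      ext x; rw [hint, hμ.toReal_moment_one hFm]
    refine ⟨hflow ▸ hμ.isLipschitzOnBounded hFm, fun x => ⟨?_, ?_, ?_⟩⟩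
    · rw [← hr.integrable_kernelMeasure_iff ht,
        integrable_congr (ae_kernelMeasure_of_ae hfF t x)]
      simpa using hμ.integrable_rpow hFm one_pos hp x
    · have := hr.integrable_kernelMeasure_iff ht x (fun z => f z * Real.log (f z))
      rw [← this, integrable_congr (ae_kernelMeasure_of_ae hlogF t x)]
      exact hμ.integrable_mul_log hFm x
    · have h1 := hμ.lip_sq_le hFm x
      -- The conclusion is stated in `EReal`, where a negative right-hand side is not truncated to
      -- `0`; its sign comes from Jensen.
      have h2 : 0 ≤ logSobolevBound m r K t f x := by
        have h3 := hμ.entropy_nonneg hFm x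
        have h4 := hμ.pos
        rw [logSobolevBound, hint', hflow]
        exact mul_nonneg (mul_nonneg h4.le ENNReal.toReal_nonneg) (sub_nonneg.2 h3)
      have h5 : lip (kernelFlow m r t f) x ^ 2 ≤ ENNReal.ofReal (logSobolevBound m r K t f x) := by
        rw [logSobolevBound, hint', hflow]
        exact h1
      refine (EReal.coe_ennreal_le_coe_ennreal_iff.2 h5).trans (le_of_eq ?_)
      rw [EReal.coe_ennreal_ofReal, max_eq_left h2]
  -- The remaining case is `F = 0` almost everywhere, where logarithms of moments are meaningless
  -- but both sides vanish.
  · obtain ⟨y, -⟩ := hfin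
    have hzero : (fun z => (F z : ℝ)) =ᵐ[m] fun _ => 0 := by
      push Not at hne
      have h0 := hne y
      rw [moment_one, lintegral_eq_zero_iff hF.coe_nnreal_ennreal] at h0
      filter_upwards [(hr.absolutelyContinuous ht y).ae_le h0] with z hz
      simpa using hz
    have hf0 : f =ᵐ[m] fun _ => 0 := hfF.trans hzero
    have hflow : kernelFlow m r t f = fun _ => 0 := by
      ext x; rw [kernelFlow_congr hf0]; simp [kernelFlow]
    refine ⟨fun B _ => ⟨0, by rw [hflow]; exact (LipschitzWith.const 0).lipschitzOnWith⟩,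
      fun x => ⟨?_, ?_, ?_⟩⟩
    · exact (integrable_zero X ℝ m).congr (hf0.mono fun z hz => by simp [hz])
    · exact (integrable_zero X ℝ m).congr (hf0.mono fun z hz => by simp [hz])
    · have h1 : lip (kernelFlow m r t f) x = 0 := by
        rw [hflow, ← nonpos_iff_eq_zero]
        exact lip_le_of_eventually (Eventually.of_forall fun y => by simp)
      rw [h1, logSobolevBound, hflow]
      simp

theorem exists_measurable_nnreal_ae_eq {f : X → ℝ} (hf : AEStronglyMeasurable f m)
    (h0 : 0 ≤ᵐ[m] f) : ∃ F : X → ℝ≥0, Measurable F ∧ f =ᵐ[m] fun z => (F z : ℝ) := by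
  refine ⟨fun z => (hf.mk f z).toNNReal, hf.stronglyMeasurable_mk.measurable.real_toNNReal, ?_⟩
  filter_upwards [hf.ae_eq_mk, h0] with z h1 h2
  rw [Real.coe_toNNReal', ← h1]
  exact (max_eq_left h2).symm

theorem exists_ae_norm_le_of_memLp_top {f : X → ℝ} (hf : MemLp f ∞ m) :
    ∃ M : ℝ≥0, ∀ᵐ z ∂m, |f z| ≤ M := by
  have h := hf.2
  rw [eLpNorm_exponent_top] at h
  refine ⟨(eLpNormEssSup f m).toNNReal, ?_⟩
  filter_upwards [enorm_ae_le_eLpNormEssSup f m] with z hz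
  have := ENNReal.toReal_mono h.ne hz
  rwa [toReal_enorm, Real.norm_eq_abs] at this

/-- Adding `M + 1` brings the values of `f` into `[1, 2M + 1]`, so log-moments are bounded uniformly
on `X` and the Lipschitz estimate holds with `B = univ`. Since each `μ_x` is a probability measure,
the shift changes the flow only by a constant. -/
theorem IsHeatKernel.exists_lipschitzWith (hr : IsHeatKernel m r) (hH : DimFreeHarnack m r K)
    (hm : ∀ s : Set X, Bornology.IsBounded s → m s < ∞) (ht : 0 < t) {f : X → ℝ}
    (hf : MemLp f ∞ m) : ∃ C : ℝ≥0, LipschitzWith C (kernelFlow m r t f) := by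
  rcases isEmpty_or_nonempty X with hX | ⟨⟨x₀⟩⟩
  · exact ⟨0, fun x => isEmptyElim x⟩
  have hμ := hr.harnackFamily hH hm ht
  obtain ⟨M, hM⟩ := exists_ae_norm_le_of_memLp_top hf
  have hgm : AEStronglyMeasurable (fun z => f z + (M + 1)) m :=
    hf.1.add aestronglyMeasurable_const
  obtain ⟨F, hF, hfF⟩ := exists_measurable_nnreal_ae_eq hgm
    (hM.mono fun z hz => by have := abs_le.1 hz; simp only [Pi.zero_apply]; linarith)
  have hlow : ∀ᵐ z ∂m, (1 : ℝ≥0) ≤ F z := by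
    filter_upwards [hM, hfF] with z h1 h2
    have := abs_le.1 h1
    rw [← NNReal.coe_le_coe, ← h2, NNReal.coe_one]; linarith
  have hup : ∀ᵐ z ∂m, F z ≤ 2 * M + 1 := by
    filter_upwards [hM, hfF] with z h1 h2
    have := abs_le.1 h1
    rw [← NNReal.coe_le_coe, ← h2]; push_cast; linarith
  have hmom_low : ∀ p : ℝ, 0 < p → ∀ x, 1 ≤ moment (kernelMeasure m r t) F p x := fun p hp x => by
    have := hμ.prob x
    rw [moment, ← measure_univ (μ := kernelMeasure m r t x), ← lintegral_one]
    refine lintegral_mono_ae ((ae_kernelMeasure_of_ae hlow t x).mono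
      fun z hz => ?_)
    exact ENNReal.one_le_rpow (by exact_mod_cast hz) hp
  have hmom_up : ∀ p : ℝ, 0 ≤ p → ∀ x,
      moment (kernelMeasure m r t) F p x ≤ ((2 * M + 1 : ℝ≥0) : ℝ≥0∞) ^ p := fun p hp x => by
    have := hμ.prob x
    rw [moment]
    refine (lintegral_mono_ae ((ae_kernelMeasure_of_ae hup t x).mono
      fun z hz => ENNReal.rpow_le_rpow (ENNReal.coe_le_coe.2 hz) hp)).trans (le_of_eq ?_)
    rw [lintegral_const, measure_univ, mul_one]
  -- Any order above `2` would do: the estimate is used with `δ = 1`, that is with moments of orders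
  -- `1` and `2`.
  have hFm : HasFiniteMoment (kernelMeasure m r t) F 3 := by
    refine ⟨hF, by norm_num, ⟨x₀, ?_⟩, ⟨x₀, ?_⟩⟩
    · exact (one_pos.trans_le (hmom_low 1 one_pos x₀)).ne'
    · exact ne_top_of_le_ne_top (ENNReal.rpow_ne_top_of_nonneg (by norm_num) ENNReal.coe_ne_top)
        (hmom_up 3 (by norm_num) x₀)
  have hlog : ∀ p : ℝ, 0 < p → p < 3 → ∀ x,
      |logMoment (kernelMeasure m r t) F p x| ≤ p * Real.log (2 * M + 1) := by
    intro p hp hp3 x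
    have h1 := ENNReal.toReal_mono (hμ.ne_top hFm hp hp3 x) (hmom_low p hp x)
    have h2 := ENNReal.toReal_mono (ENNReal.rpow_ne_top_of_nonneg hp.le ENNReal.coe_ne_top)
      (hmom_up p hp.le x)
    rw [← ENNReal.toReal_rpow, ENNReal.coe_toReal] at h2
    rw [ENNReal.toReal_one] at h1
    push_cast at h2
    rw [logMoment, abs_of_nonneg (Real.log_nonneg h1)]
    have h3 := Real.log_le_log (one_pos.trans_le h1) h2
    rwa [Real.log_rpow (by positivity)] at h3
  have hL : 0 ≤ Real.log (2 * M + 1) := Real.log_nonneg (by simp)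
  obtain ⟨C, hC⟩ := hμ.exists_lipschitzOnWith hFm (δ := 1) (M := 2 * Real.log (2 * M + 1))
    (B := univ) one_pos (by norm_num)
    (fun x _ => (hlog 1 one_pos (by norm_num) x).trans (by linarith))
    (fun x _ => by
      have := hlog 2 two_pos (by norm_num) x
      norm_num; exact this)
  refine ⟨C, ?_⟩
  rw [lipschitzOnWith_univ] at hC
  have hflow : kernelFlow m r t f
      = fun x => (moment (kernelMeasure m r t) F 1 x).toReal - (M + 1) := by
    ext x
    have := hμ.prob x
    have hi : Integrable (fun z => (F z : ℝ)) (kernelMeasure m r t x) := by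
      simpa using hμ.integrable_rpow hFm one_pos (by norm_num) x
    rw [hμ.toReal_moment_one hFm, ← hr.integral_kernelMeasure ht]
    have h1 : ∫ z, f z ∂kernelMeasure m r t x
        = ∫ z, ((F z : ℝ) - (M + 1)) ∂kernelMeasure m r t x :=
      integral_congr_ae ((ae_kernelMeasure_of_ae hfF t x).mono
        fun z hz => by simp only [← hz]; ring)
    rw [h1, integral_sub hi (integrable_const _), integral_const]
    simp
  rw [hflow]
  refine LipschitzWith.of_dist_le_mul fun x y => ?_
  rw [dist_sub_right]
  exact hC.dist_le_mul x y

end Kernel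

end HeatMMS

theorem proposition3p2 {X : Type*} [MetricSpace X] [CompleteSpace X] [SecondCountableTopology X]
    [MeasurableSpace X] [BorelSpace X] (m : Measure X)
    (hm : ∀ s : Set X, Bornology.IsBounded s → m s < ∞)
    (r : ℝ → X → X → ℝ) (hr : IsHeatKernel m r)
    (K : ℝ) (hH : DimFreeHarnack m r K) (t : ℝ) (ht : 0 < t) :
    (∀ f : X → ℝ, MemLp f ∞ m → ∃ C : ℝ≥0, LipschitzWith C (kernelFlow m r t f)) ∧
    (∀ f : X → ℝ, MemLp f ∞ m → 0 ≤ᵐ[m] f → ∀ x,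
      ((lip (kernelFlow m r t f) x ^ 2 : ℝ≥0∞) : EReal) ≤ (logSobolevBound m r K t f x : ℝ)) ∧
    (∀ p : ℝ, 1 < p → ∀ f : X → ℝ, MemLp f (ENNReal.ofReal p) m → 0 ≤ᵐ[m] f →
      (∀ᵐ x ∂m, Integrable (fun y => f y * r t x y) m ∧
        Integrable (fun y => f y * Real.log (f y) * r t x y) m) ∧
      IsMinimalWeakUpperGradient m (kernelFlow m r t f)
        (minWeakUpperGradient m (kernelFlow m r t f)) ∧
      ∀ᵐ x ∂m, ((minWeakUpperGradient m (kernelFlow m r t f) x ^ 2 : ℝ≥0∞) : EReal) ≤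
        (logSobolevBound m r K t f x : ℝ)) := by
  have hloc : IsLocallyFiniteMeasure m :=
    ⟨fun x => ⟨Metric.ball x 1, Metric.ball_mem_nhds x one_pos, hm _ Metric.isBounded_ball⟩⟩
  refine ⟨fun f hf => hr.exists_lipschitzWith hH hm ht hf, fun f hf h0 x => ?_,
    fun p hp f hf h0 => ?_⟩
  · obtain ⟨F, hF, hfF⟩ := exists_measurable_nnreal_ae_eq hf.1 h0
    obtain ⟨M, hM⟩ := exists_ae_norm_le_of_memLp_top hf
    refine ((hr.regularity hH hm ht hF hfF one_lt_two ⟨x, ?_⟩).2 x).2.2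
    have := hr.isProbabilityMeasure ht x
    have hup : ∀ᵐ z ∂m, F z ≤ M := by
      filter_upwards [hM, hfF] with z h1 h2
      rw [← NNReal.coe_le_coe, ← h2]
      exact (abs_le.1 h1).2
    refine ne_top_of_le_ne_top (b := ∫⁻ _, (M : ℝ≥0∞) ^ (2 : ℝ) ∂kernelMeasure m r t x) ?_
      (lintegral_mono_ae ((ae_kernelMeasure_of_ae hup t x).mono
        fun z hz => ENNReal.rpow_le_rpow (ENNReal.coe_le_coe.2 hz) zero_le_two))
    rw [lintegral_const, measure_univ, mul_one]
    exact ENNReal.rpow_ne_top_of_nonneg zero_le_two ENNReal.coe_ne_top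
  · have hp0 : 0 < p := one_pos.trans hp
    obtain ⟨F, hF, hfF⟩ := exists_measurable_nnreal_ae_eq hf.1 h0
    have hreg : IsLipschitzOnBounded (kernelFlow m r t f) ∧ ∀ x,
        Integrable (fun y => f y * r t x y) m ∧
        Integrable (fun y => f y * Real.log (f y) * r t x y) m ∧
        ((lip (kernelFlow m r t f) x ^ 2 : ℝ≥0∞) : EReal) ≤
          (logSobolevBound m r K t f x : ℝ) := by
      rcases isEmpty_or_nonempty X with hX | ⟨⟨x₀⟩⟩
      · exact ⟨fun B _ => ⟨0, fun x => isEmptyElim x⟩, fun x => isEmptyElim x⟩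
      refine hr.regularity hH hm ht hF hfF hp ?_
      have hFp : ∫⁻ z, ((F z ^ p : ℝ≥0) : ℝ≥0∞) ∂m ≠ ∞ := by
        have h1 := hf.2
        rw [eLpNorm_lt_top_iff_lintegral_rpow_enorm_lt_top (by simpa using hp0)
          ENNReal.ofReal_ne_top, ENNReal.toReal_ofReal hp0.le] at h1
        refine (lt_of_le_of_lt (le_of_eq (lintegral_congr_ae ?_)) h1).ne
        filter_upwards [hfF] with z hz
        rw [hz, NNReal.enorm_eq, ENNReal.coe_rpow_of_nonneg _ hp0.le]
      -- Applied to `F ^ p`, which is integrable with respect to `m`, this yields a point where the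
      -- moment of order `p` is finite.
      obtain ⟨y, hy⟩ := hr.exists_lintegral_ne_top ht (hF.pow_const p) hFp hm x₀
      refine ⟨y, ?_⟩
      simpa only [moment, ENNReal.coe_rpow_of_nonneg _ hp0.le] using hy
    -- Minimality puts the minimal gradient below `lip`, for which the bound holds at every point.
    have hw := hreg.1.isWeakUpperGradient_lip (m := m)
    have hmin := isMinimalWeakUpperGradient_minWeakUpperGradient hw
    refine ⟨Eventually.of_forall fun x => ⟨(hreg.2 x).1, (hreg.2 x).2.1⟩, hmin, ?_⟩
    filter_upwards [hmin.2 _ hw] with x hx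
    exact (EReal.coe_ennreal_le_coe_ennreal_iff.2 (pow_le_pow_left' hx 2)).trans (hreg.2 x).2.2
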